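/- Let $h(x)=\sum_{k=0}^{n}a_{2k+1}x^{2k+1}$ be an odd real polynomial (of degree at most $2n+1$) with $\sum_{k=0}^{n}a_{2k+1}=0$, and suppose that $$G(x)=\frac{1+h(x)-x\,h'(x)}{(1+h(x))^3}>0\qquad\text{for all }x\in[-1,1]$$ (in particular $1+h\neq 0$ on $[-1,1]$, hence $|h|<1$ there). Let $\Lambda=\mathbb S^2$ carry the Zoll metric of revolution $$g=(1+h(\cos r))^2\,dr^2+\sin^2 r\,d\theta^2,$$ whose Gauss curvature is $G(\cos r)$, oriented by $\partial_r,\partial_\theta$. Let $\Sigma=U\Lambda$ be its unit tangent bundle, $M$ the manifold of oriented unit speed geodesics of $g$ (up to a shift of the parameter), and $\pi:\Sigma\to M$ the projection sending a unit vector to the geodesic it generates. Away from the two equators, let $(R,\Theta)\in(-\frac\pi2,\frac\pi2)\times\mathbb R/2\pi\mathbb Z$ be the coordinates on $M$ for which the geodesic with coordinates $(R,\Theta)$ is the one passing through the point $(\sin R\cos\Theta,\sin R\sin\Theta,\cos R)$ of $\mathbb S^2\subset\mathbb R^3$ with velocity $(-\sin\Theta,\cos\Theta,0)$; here $(\sin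 r\cos\theta,\sin r\sin\theta,\cos r)$ is the point with spherical coordinates $(r,\theta)$, and the geodesic has Clairaut constant $c=\sin R$. Let $\hat v_3$ be the vector field on $\Sigma$ generating the positive rotation of unit vectors in the tangent planes of $\Lambda$, and let $\hat e_2=-\hat v_3$. The Finsler structure of constant flag curvature $1$ on $M$ induced by $g$ has at $x\in M$ the indicatrix $\{\pi_{*,u}(\hat e_2): u\in\Sigma,\ \pi(u)=x\}\subset T_xM$. Then, for all $R\in(-\frac\pi2,\frac\pi2)$ and all $\Theta$, the Finsler indicatrix at $(R,\Theta)$ is exactly the set of the tangent vectors $v_1\frac{\partial}{\partial R}+v_2\frac{\partial}{\partial\Theta}$ such that $v_1^2\le 1$ and, for one of the two choices of the sign $\pm$, $$v_2=\pm\frac{\sqrt{1-v_1^2}}{\cos R}-\sum_{k=0}^{n}a_{2k+1}\cos^{2k}R\,(1+2kv_1^2)(1-v_1^2)^k-\cos^2R\;v_1^4\sum_{k=0}^{n-1}b_{2k+1}\cos^{2k}R\sum_{\rho=0}^{k}\frac{(-1)^\rho}{2\rho+3}\binom{k}{\rho}v_1^{2\rho},$$ where $b_{2k+1}=2(k+1)(2k+3)a_{2k+3}$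 for $0\le k\le n-1$. -/

import Mathlib

open scoped Matrix Topology

noncomputable section

/-- The Zoll metric of revolution attached to `h`, on the unit sphere of `ℝ³`:
`zollMetric h p v w = g_p(v, w)` for `v, w` tangent to the sphere at `p`.  Writing
`p = (sin r cos θ, sin r sin θ, cos r)`, the Euclidean product restricts to
`dr² + sin² r dθ²` and `dz = - sin r dr`, so this is the metric
`g = (1 + h (cos r))² dr² + sin² r dθ²` (see `zollMetric_spherical`).  At the two poles tangent
vectors are horizontal and the last term vanishes whatever its coefficient is. -/
def zollMetric (h : ℝ → ℝ) (p v w : Fin 3 → ℝ) : ℝ :=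
  v ⬝ᵥ w + h (p 2) * (2 + h (p 2)) / (1 - p 2 ^ 2) * (v 2 * w 2)

/-- The point of the sphere with spherical coordinates `(r, θ)`.  Negative `r` is allowed: `(r, θ)`
and `(-r, θ + π)` are the same point. -/
def spherePoint (r θ : ℝ) : Fin 3 → ℝ :=
  ![Real.sin r * Real.cos θ, Real.sin r * Real.sin θ, Real.cos r]

/-- In spherical coordinates the squared length of `α ∂/∂r + β ∂/∂θ` is
`(1 + h (cos r))² α² + sin² r β²`. -/
theorem zollMetric_spherical (h : ℝ → ℝ) (r θ α β : ℝ) (hr : Real.sin r ≠ 0) :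
    let X : Fin 3 → ℝ :=
      α • ![Real.cos r * Real.cos θ, Real.cos r * Real.sin θ, -Real.sin r] +
      β • ![-(Real.sin r * Real.sin θ), Real.sin r * Real.cos θ, 0]
    zollMetric h (spherePoint r θ) X X =
      (1 + h (Real.cos r)) ^ 2 * α ^ 2 + Real.sin r ^ 2 * β ^ 2 := by
  intro X
  have e : 1 - Real.cos r ^ 2 = Real.sin r ^ 2 := by
    linarith [Real.sin_sq_add_cos_sq r]
  have e1 := Real.sin_sq_add_cos_sq r
  have e2 := Real.sin_sq_add_cos_sq θ
  have key : zollMetric h (spherePoint r θ) X X =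
      (Real.cos r ^ 2 * α ^ 2 + Real.sin r ^ 2 * β ^ 2) *
          (1 * (Real.sin θ ^ 2 + Real.cos θ ^ 2)) + Real.sin r ^ 2 * α ^ 2
        + h (Real.cos r) * (2 + h (Real.cos r)) * α ^ 2 := by
    simp only [zollMetric, spherePoint, X, dotProduct, Fin.sum_univ_three]
    simp only [Pi.add_apply, Pi.smul_apply, smul_eq_mul, Matrix.cons_val]
    rw [e]
    field_simp
    ring
  rw [key, e2]
  linear_combination α ^ 2 * e1

/-- The Gauss curvature of the Zoll metric at the points with `cos r = x`. -/
def zollGaussCurvature (h : ℝ → ℝ) (x : ℝ) : ℝ :=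
  (1 + h x - x * deriv h x) / (1 + h x) ^ 3

/-- Unit speed geodesics `ℝ → S²` of the Zoll metric.  The geodesic equation is the Euler–Lagrange
equation of the energy `½ g(γ', γ')` on the sphere, tested against all tangent vectors `w`.
It is imposed away from the poles, where the ambient formula for `g` is smooth; as the curve is
twice continuously differentiable, of unit speed, and the metric is smooth on the sphere,
it then holds at the poles by continuity. -/
structure IsUnitGeodesic (h : ℝ → ℝ) (γ : ℝ → Fin 3 → ℝ) : Prop where
  contDiff : ContDiff ℝ 2 γ
  mem_sphere : ∀ t, γ t ⬝ᵥ γ t = 1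
  unit_speed : ∀ t, zollMetric h (γ t) (deriv γ t) (deriv γ t) = 1
  euler_lagrange : ∀ t, γ t 2 ^ 2 ≠ 1 → ∀ w : Fin 3 → ℝ, γ t ⬝ᵥ w = 0 →
    deriv (fun s => zollMetric h (γ s) (deriv γ s) w) t =
      1 / 2 * deriv (fun s : ℝ => zollMetric h (γ t + s • w) (deriv γ t) (deriv γ t)) 0

/-- `(p, u)` is a point of the unit tangent bundle `Σ = UΛ` of the Zoll sphere. -/
structure IsUnitTangent (h : ℝ → ℝ) (p u : Fin 3 → ℝ) : Prop where
  mem_sphere : p ⬝ᵥ p = 1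
  tangent : p ⬝ᵥ u = 0
  unit : zollMetric h p u u = 1

/-- `m` is the unit normal of the unit tangent vector `u` at `p` for which `u, m` is positively
oriented; the orientation of the sphere is that of `∂/∂r, ∂/∂θ`, i.e. the one of the outer normal
`p`. -/
structure IsUnitNormal (h : ℝ → ℝ) (p u m : Fin 3 → ℝ) : Prop where
  tangent : p ⬝ᵥ m = 0
  unit : zollMetric h p m m = 1
  orthogonal : zollMetric h p u m = 0
  positive : 0 < p ⬝ᵥ (u ⨯₃ m)

/-- The coordinates `(R, Θ)`, `-π/2 < R < π/2`, on the manifold `M` of oriented geodesics (i.e. unit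
speed geodesics up to a shift of the parameter) without the two equators.  The oriented geodesic
with coordinates `(R, Θ)` passes through the point `spherePoint R Θ`, its point nearest to the
north pole, with the horizontal unit velocity `(- sin Θ, cos Θ, 0)`, and has Clairaut constant
`c = sin R`.  In terms of the spherical coordinates `(r, θ)` of that point: if `c > 0` then
`(R, Θ) = (r, θ)`; if `c < 0` then `(R, Θ) = (-r, θ + π)`; if `c = 0` then `R = 0` and `Θ + π/2` is
the angle of the velocity at the north pole. -/
def HasGeodesicCoords (γ : ℝ → Fin 3 → ℝ) (R Θ : ℝ) : Prop :=
  -(Real.pi / 2) < R ∧ R < Real.pi / 2 ∧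
    ∃ t, γ t = spherePoint R Θ ∧ deriv γ t = ![-Real.sin Θ, Real.cos Θ, 0]

/-- The projection `π : Σ → M` in the coordinates `(R, Θ)`: the geodesic with initial velocity
`u` at `p`, as a point of `M`, has coordinates `(R, Θ)`. -/
def ProjectsTo (h : ℝ → ℝ) (p u : Fin 3 → ℝ) (R Θ : ℝ) : Prop :=
  ∃ γ, IsUnitGeodesic h γ ∧ γ 0 = p ∧ deriv γ 0 = u ∧ HasGeodesicCoords γ R Θ

/-- `v₁ ∂/∂R + v₂ ∂/∂Θ`, a tangent vector of `M` at `(R, Θ)`, is the image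
`ι(p, u) = π_*(ê₂)` of `(p, u) ∈ Σ` under the canonical immersion `ι : Σ → TM`.

If `θ¹, θ², θ³` is the coframe of the metric on `Σ` dual to the frame `v̂₁ = (m, 0)`,
`v̂₂ = (u, 0)`, `v̂₃ = (0, m)` (horizontal and vertical components), the coframe of the Finsler
structure is `ω¹ = √G θ¹`, `ω² = - θ³`, `ω³ = √G θ²`, so the second vector of its dual frame is
`ê₂ = - v̂₃`.  The curve `s ↦ cos s • u - sin s • m` in the unit circle at `p` has velocity `ê₂`
at `s = 0`; the tangent vector `π_*(ê₂)` is the velocity at `s = 0` of its projection to `M`,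
computed in the coordinates `(R, Θ)`. -/
def IsCanonicalImage (h : ℝ → ℝ) (p u : Fin 3 → ℝ) (R Θ : ℝ) (v : ℝ × ℝ) : Prop :=
  ∃ m, IsUnitNormal h p u m ∧
    ∃ ρ ϑ : ℝ → ℝ, ρ 0 = R ∧ ϑ 0 = Θ ∧ HasDerivAt ρ v.1 0 ∧ HasDerivAt ϑ v.2 0 ∧
      ∀ᶠ s in 𝓝 (0 : ℝ), ProjectsTo h p (Real.cos s • u - Real.sin s • m) (ρ s) (ϑ s)

/-- The indicatrix, at the point `(R, Θ)` of the manifold of geodesics `M`, of the Finsler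
structure induced by the Zoll metric: the image under `ι` of the fibre of `π : Σ → M` over that
point, in the coordinates `(v₁, v₂)` of the tangent plane with respect to `∂/∂R, ∂/∂Θ`. -/
def finslerIndicatrix (h : ℝ → ℝ) (R Θ : ℝ) : Set (ℝ × ℝ) :=
  {v | ∃ p u, IsUnitTangent h p u ∧ ProjectsTo h p u R Θ ∧ IsCanonicalImage h p u R Θ v}

end

/-! Since the coefficients of `h` sum to zero and `h` is odd, `h x = (1 - x²) k x` with `k` an odd
polynomial. Parametrize a geodesic with Clairaut constant `sin R` by a phase `φ` with height `z =
cos R * cos φ`. Clairaut's relation gives `dt/dφ = 1 + h z` and `dθ/dφ = sin R * (1 + h z) / (1 -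
z²)`, which is the rate on a round great circle plus `sin R * k z`. So the geodesic is a great
circle rotated about the axis by `β = Θ + Ψ`, where `Ψ = sin R * ∫ k (cos R * cos φ) dφ`. Because
`k` is odd, only odd powers of `cos φ` are integrated, and `Ψ` is a polynomial in `sin φ`, hence
periodic: this is the Zoll property.

Now fix the base point `p` and turn the unit vector. Then `R`, `sin φ` and `β` move exactly as on
the round sphere: `R' = -sin φ`, `(sin φ)' = tan R * cos² φ`, `β' = -cos φ / cos R`. Since `Θ = β -
Ψ`, the image of `ê₂` is `v₁ = -sin φ`, `v₂ = -cos φ / cos R - Ψ'`. A reduction formula and a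
summation by parts turn `Ψ'` into `indicatrixShift`, which `indicatrixShift_eq` rewrites as the two
sums of the theorem.

The geometric input is that the geodesics are exactly these curves. Existence is
`isUnitGeodesic_phase`; `exists_hasPhase` shows that any geodesic is of this form, by exhibiting two
planar vectors that rotate at known rates. Together they give `projectsTo_iff`, which makes the
projection to `M` algebraic. `canonicalImage_eq` and `exists_canonicalImage` then compute the image
of `ê₂` and show that it exists. -/

open Real

/-! ### Integrals of odd powers of the cosine, and sums built from them -/

/-- The primitive of `(1 - t²) ^ k` vanishing at `0`; at `sin φ` it is `∫₀^φ cos ^ (2 k + 1)`. -/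
noncomputable def cosPowPrimitive (k : ℕ) (S : ℝ) : ℝ := ∫ t in (0 : ℝ)..S, (1 - t ^ 2) ^ k

theorem cosPowPrimitive_zero (k : ℕ) : cosPowPrimitive k 0 = 0 := by
  simp [cosPowPrimitive]

theorem hasDerivAt_cosPowPrimitive (k : ℕ) (S : ℝ) :
    HasDerivAt (cosPowPrimitive k) ((1 - S ^ 2) ^ k) S := by
  have hc : Continuous fun t : ℝ => (1 - t ^ 2) ^ k := by fun_prop
  exact intervalIntegral.integral_hasDerivAt_right (hc.intervalIntegrable _ _)
    hc.aestronglyMeasurable.stronglyMeasurableAtFilter hc.continuousAt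

theorem eq_of_hasDerivAt_eq {f g f' : ℝ → ℝ} (hf : ∀ x, HasDerivAt f (f' x) x)
    (hg : ∀ x, HasDerivAt g (f' x) x) (x₀ : ℝ) (h₀ : f x₀ = g x₀) (x : ℝ) : f x = g x := by
  have hd : ∀ y, HasDerivAt (fun y => f y - g y) 0 y := fun y =>
    ((hf y).fun_sub (hg y)).congr_deriv (sub_self _)
  have := is_const_of_deriv_eq_zero (fun y => (hd y).differentiableAt) (fun y => (hd y).deriv) x x₀
  simp only [h₀, sub_self] at this
  linarith

/-- Reduction formula for `∫ cos ^ (2 k + 3)`, by comparing derivatives; it brings the derivative of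
`Ψ` into closed form. -/
theorem cosPowPrimitive_succ (k : ℕ) (S : ℝ) :
    (2 * k + 3) * cosPowPrimitive (k + 1) S =
      S * (1 - S ^ 2) ^ (k + 1) + (2 * k + 2) * cosPowPrimitive k S := by
  refine eq_of_hasDerivAt_eq (f := fun S => (2 * (k : ℝ) + 3) * cosPowPrimitive (k + 1) S)
    (g := fun S => S * (1 - S ^ 2) ^ (k + 1) + (2 * (k : ℝ) + 2) * cosPowPrimitive k S)
    (f' := fun S => (2 * k + 3) * (1 - S ^ 2) ^ (k + 1))
    (fun x => (hasDerivAt_cosPowPrimitive (k + 1) x).const_mul _) (fun x => ?_) 0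
    (by simp [cosPowPrimitive_zero]) S
  have h1 : HasDerivAt (fun S : ℝ => 1 - S ^ 2) (-(2 * x)) x := by
    simpa using (hasDerivAt_pow 2 x).const_sub 1
  refine (((hasDerivAt_id x).mul (h1.pow (k + 1))).add
    ((hasDerivAt_cosPowPrimitive k x).const_mul (2 * (k : ℝ) + 2))).congr_deriv ?_
  simp
  ring

/-- Both sides have derivative `(2 k + 2) S² (1 - S²) ^ k`: on the left by the binomial theorem.
This is the origin of the inner sum of the main formula. -/
theorem sum_choose_eq_cosPowPrimitive (k : ℕ) (S : ℝ) :
    (2 * k + 2) * (S ^ 3 * ∑ ρ ∈ Finset.range (k + 1),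
      (-1 : ℝ) ^ ρ / (2 * (ρ : ℝ) + 3) * (k.choose ρ : ℝ) * S ^ (2 * ρ)) =
      cosPowPrimitive (k + 1) S - S * (1 - S ^ 2) ^ (k + 1) := by
  refine eq_of_hasDerivAt_eq
    (f := fun S => (2 * (k : ℝ) + 2) * (S ^ 3 * ∑ ρ ∈ Finset.range (k + 1),
      (-1 : ℝ) ^ ρ / (2 * (ρ : ℝ) + 3) * (k.choose ρ : ℝ) * S ^ (2 * ρ)))
    (g := fun S => cosPowPrimitive (k + 1) S - S * (1 - S ^ 2) ^ (k + 1))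
    (f' := fun S => (2 * k + 2) * (S ^ 2 * (1 - S ^ 2) ^ k))
    (fun x => ?_) (fun x => ?_) 0 (by simp [cosPowPrimitive_zero]) S
  · refine HasDerivAt.const_mul _ ?_
    have e : (fun S : ℝ => S ^ 3 * ∑ ρ ∈ Finset.range (k + 1),
        (-1 : ℝ) ^ ρ / (2 * (ρ : ℝ) + 3) * (k.choose ρ : ℝ) * S ^ (2 * ρ)) =
        fun S => ∑ ρ ∈ Finset.range (k + 1),
          (-1 : ℝ) ^ ρ / (2 * (ρ : ℝ) + 3) * (k.choose ρ : ℝ) * S ^ (2 * ρ + 3) := by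
      funext S
      rw [Finset.mul_sum]
      exact Finset.sum_congr rfl fun ρ _ => by ring
    rw [e]
    refine (HasDerivAt.fun_sum fun ρ _ => (hasDerivAt_pow (2 * ρ + 3) x).const_mul
      ((-1 : ℝ) ^ ρ / (2 * (ρ : ℝ) + 3) * (k.choose ρ : ℝ))).congr_deriv ?_
    rw [sub_eq_neg_add, add_pow, Finset.mul_sum]
    refine Finset.sum_congr rfl fun ρ _ => ?_
    have : (2 * (ρ : ℝ) + 3) ≠ 0 := by positivity
    have e2 : (-x ^ 2) ^ ρ = (-1) ^ ρ * x ^ (2 * ρ) := by rw [neg_pow, pow_mul]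
    push_cast
    rw [e2]
    field_simp
    simp
    ring
  · have h1 : HasDerivAt (fun S : ℝ => 1 - S ^ 2) (-(2 * x)) x := by
      simpa using (hasDerivAt_pow 2 x).const_sub 1
    refine ((hasDerivAt_cosPowPrimitive (k + 1) x).sub
      ((hasDerivAt_id x).mul (h1.pow (k + 1)))).congr_deriv ?_
    simp
    ring

/-- When the `α k` sum to zero the boundary term drops, leaving the partial sums, which are the
coefficients of the quotient by `1 - x²`. -/
theorem sum_range_succ_by_parts (α g : ℕ → ℝ) (n : ℕ) :
    ∑ k ∈ Finset.range (n + 1), α k * g k =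
      ∑ j ∈ Finset.range n, (∑ i ∈ Finset.range (j + 1), α i) * (g j - g (j + 1)) +
        (∑ i ∈ Finset.range (n + 1), α i) * g n := by
  induction n with
  | zero => simp
  | succ n ih =>
    rw [Finset.sum_range_succ (fun k => α k * g k), ih,
      Finset.sum_range_succ (fun j => (∑ i ∈ Finset.range (j + 1), α i) * (g j - g (j + 1))),
      Finset.sum_range_succ α (n + 1)]
    ring

/-! ### The quotient `k`, the rotation `Ψ`, the delay `H`, and the derivative of `Ψ` -/

/-- The odd polynomial `x ↦ ∑ α k * x ^ (2 k + 1)`, divided by `1 - x²`; the sum of the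
coefficients is assumed to vanish. -/
noncomputable def oddQuotient (α : ℕ → ℝ) (n : ℕ) (x : ℝ) : ℝ :=
  ∑ j ∈ Finset.range n, (∑ i ∈ Finset.range (j + 1), α i) * x ^ (2 * j + 1)

theorem one_sub_sq_mul_oddQuotient {α : ℕ → ℝ} {n : ℕ}
    (hα : ∑ k ∈ Finset.range (n + 1), α k = 0) (x : ℝ) :
    ∑ k ∈ Finset.range (n + 1), α k * x ^ (2 * k + 1) = (1 - x ^ 2) * oddQuotient α n x := by
  rw [sum_range_succ_by_parts α (fun k => x ^ (2 * k + 1)), hα, zero_mul, add_zero, oddQuotient,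
    Finset.mul_sum]
  exact Finset.sum_congr rfl fun j _ => by ring

theorem contDiff_oddQuotient (α : ℕ → ℝ) (n : ℕ) : ContDiff ℝ 2 (oddQuotient α n) := by
  unfold oddQuotient
  fun_prop

/-- The angle by which the geodesic with nearest colatitude `R` is ahead, at phase `φ` with
`sin φ = S`, of the corresponding great circle of the round sphere. -/
noncomputable def phaseRotation (α : ℕ → ℝ) (n : ℕ) (R S : ℝ) : ℝ :=
  sin R * ∑ j ∈ Finset.range n,
    (∑ i ∈ Finset.range (j + 1), α i) * cos R ^ (2 * j + 1) * cosPowPrimitive j S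

/-- The time by which the geodesic with nearest colatitude `R` is late, at phase `φ` with
`sin φ = S`, compared to the corresponding great circle of the round sphere. -/
noncomputable def phaseDelay (α : ℕ → ℝ) (n : ℕ) (R S : ℝ) : ℝ :=
  ∑ k ∈ Finset.range (n + 1), α k * cos R ^ (2 * k + 1) * cosPowPrimitive k S

/-- An odd power of `cos φ` has a primitive that is a polynomial in `sin φ`. Here oddness of `h`
makes rotation and delay periodic in `φ`. -/
theorem hasDerivAt_cosPowPrimitive_sin (k : ℕ) (φ : ℝ) :
    HasDerivAt (fun φ => cosPowPrimitive k (sin φ)) (cos φ ^ (2 * k + 1)) φ := by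
  refine ((hasDerivAt_cosPowPrimitive k (sin φ)).comp φ (hasDerivAt_sin φ)).congr_deriv ?_
  rw [← cos_sq', ← pow_mul, pow_succ]

theorem hasDerivAt_phaseRotation_sin (α : ℕ → ℝ) (n : ℕ) (R φ : ℝ) :
    HasDerivAt (fun φ => phaseRotation α n R (sin φ))
      (sin R * oddQuotient α n (cos R * cos φ)) φ := by
  refine HasDerivAt.const_mul _ ((HasDerivAt.fun_sum fun j _ =>
    (hasDerivAt_cosPowPrimitive_sin j φ).const_mul _).congr_deriv ?_)
  exact Finset.sum_congr rfl fun j _ => by rw [mul_pow]; ring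

theorem hasDerivAt_phaseDelay_sin (α : ℕ → ℝ) (n : ℕ) (R φ : ℝ) :
    HasDerivAt (fun φ => phaseDelay α n R (sin φ))
      (∑ k ∈ Finset.range (n + 1), α k * (cos R * cos φ) ^ (2 * k + 1)) φ := by
  refine (HasDerivAt.fun_sum fun j _ =>
    (hasDerivAt_cosPowPrimitive_sin j φ).const_mul _).congr_deriv ?_
  exact Finset.sum_congr rfl fun j _ => by rw [mul_pow]; ring

theorem continuous_phaseDelay (α : ℕ → ℝ) (n : ℕ) (R : ℝ) : Continuous (phaseDelay α n R) := by
  have : ∀ k, Continuous (cosPowPrimitive k) := fun k =>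
    continuous_iff_continuousAt.2 fun S => (hasDerivAt_cosPowPrimitive k S).continuousAt
  unfold phaseDelay
  fun_prop

/-- The part of the second component of a vector of the indicatrix that depends on the metric. -/
noncomputable def indicatrixShift (α : ℕ → ℝ) (n : ℕ) (R S : ℝ) : ℝ :=
  ∑ k ∈ Finset.range (n + 1), α k * (cos R ^ (2 * k) *
    ((1 - S ^ 2) ^ (k + 1) + (2 * k + 1) * S * cosPowPrimitive k S))

/-- The derivatives prescribed for `ρ` and `σ` are those of the nearest colatitude and of `sin φ`
when a unit vector turns at a fixed point. Both sides become sums over the coefficients of `k`, and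
the summands agree by the reduction formula. -/
theorem hasDerivAt_phaseRotation_curve {α : ℕ → ℝ} {n : ℕ}
    (hα : ∑ k ∈ Finset.range (n + 1), α k = 0) {ρ σ : ℝ → ℝ} {s R S : ℝ} (hρ : ρ s = R)
    (hσ : σ s = S) (hR : cos R ≠ 0) (hρ' : HasDerivAt ρ (-S) s)
    (hσ' : HasDerivAt σ (sin R / cos R * (1 - S ^ 2)) s) :
    HasDerivAt (fun s => phaseRotation α n (ρ s) (σ s)) (indicatrixShift α n R S) s := by
  subst hρ hσ
  have hI : ∀ j, HasDerivAt (fun s => cosPowPrimitive j (σ s)) _ s := fun j =>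
    (hasDerivAt_cosPowPrimitive j (σ s)).comp s hσ'
  refine (hρ'.sin.mul (HasDerivAt.fun_sum fun j _ =>
    ((hρ'.cos.pow (2 * j + 1)).const_mul (∑ i ∈ Finset.range (j + 1), α i)).mul
      (hI j))).congr_deriv ?_
  rw [indicatrixShift, sum_range_succ_by_parts, hα, zero_mul, add_zero, Finset.mul_sum,
    Finset.mul_sum, ← Finset.sum_add_distrib]
  refine Finset.sum_congr rfl fun j _ => ?_
  have h1 := cosPowPrimitive_succ j (σ s)
  have h2 := sin_sq_add_cos_sq (ρ s)
  generalize (∑ i ∈ Finset.range (j + 1), α i) = κ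
  have e1 : cos (ρ s) ^ (2 * (j + 1)) = cos (ρ s) ^ 2 * cos (ρ s) ^ (2 * j) := by ring
  have e2 : cos (ρ s) ^ (2 * j + 1) = cos (ρ s) * cos (ρ s) ^ (2 * j) := by ring
  simp only [Pi.mul_apply, Pi.pow_apply, e1, e2, Nat.add_sub_cancel]
  generalize cos (ρ s) ^ (2 * j) = Y at *
  push_cast
  field_simp
  linear_combination κ * Y * cos (ρ s) ^ 2 * σ s * h1 + κ * Y *
    ((2 * j + 1) * σ s * cosPowPrimitive j (σ s) + (1 - σ s ^ 2) ^ (j + 1)) * h2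

/-- For index `k + 1`, split `cosPowPrimitive (k + 1) S` into `S (1 - S²) ^ (k + 1)` and a
remainder. The first part joins `(1 - S²) ^ (k + 2)` to give `(1 + 2 (k + 1) S²) (1 - S²) ^ (k +
1)`; the remainder is the `b`-term, with factors `2 k + 3` from the shift and `2 k + 2` from the
binomial sum. The term of index `0` has no remainder. -/
theorem indicatrixShift_eq (n : ℕ) (a b : ℕ → ℝ)
    (hb : ∀ k < n, b (2 * k + 1) = 2 * ((k : ℝ) + 1) * (2 * (k : ℝ) + 3) * a (2 * k + 3))
    (R S : ℝ) :
    indicatrixShift (fun k => a (2 * k + 1)) n R S =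
      ∑ k ∈ Finset.range (n + 1),
              a (2 * k + 1) * cos R ^ (2 * k) * (1 + 2 * (k : ℝ) * S ^ 2) * (1 - S ^ 2) ^ k
          + cos R ^ 2 * S ^ 4 *
              ∑ k ∈ Finset.range n, b (2 * k + 1) * cos R ^ (2 * k) *
                ∑ ρ ∈ Finset.range (k + 1),
                  (-1 : ℝ) ^ ρ / (2 * (ρ : ℝ) + 3) * (k.choose ρ : ℝ) * S ^ (2 * ρ) := by
  have key : ∀ k ∈ Finset.range n, cos R ^ 2 * S ^ 4 * (b (2 * k + 1) * cos R ^ (2 * k) *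
      ∑ ρ ∈ Finset.range (k + 1),
        (-1 : ℝ) ^ ρ / (2 * (ρ : ℝ) + 3) * (k.choose ρ : ℝ) * S ^ (2 * ρ)) =
      a (2 * (k + 1) + 1) * (cos R ^ (2 * (k + 1)) * ((2 * (k + 1 : ℕ) + 1) * S *
        (cosPowPrimitive (k + 1) S - S * (1 - S ^ 2) ^ (k + 1)))) := fun k hk => by
    rw [hb k (Finset.mem_range.1 hk), ← sum_choose_eq_cosPowPrimitive]
    push_cast
    ring_nf
  have h0 : cosPowPrimitive 0 S = S := by simp [cosPowPrimitive]
  rw [indicatrixShift, Finset.mul_sum, Finset.sum_congr rfl key, Finset.sum_range_succ',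
    Finset.sum_range_succ' _ n, add_right_comm, ← Finset.sum_add_distrib, h0]
  congr 1
  · refine Finset.sum_congr rfl fun k _ => ?_
    push_cast
    ring
  · norm_num
    ring

/-! ### The metric of a profile and its Euler–Lagrange equation -/

/-- `h` vanishes at `±1` with quotient `k`, the numbers `1 + h` are positive on `[-1, 1]`, and
`Ψ R (sin φ)`, `H R (sin φ)` integrate `sin R * k (cos R * cos φ)` and `h (cos R * cos φ)`. -/
structure IsZollProfile (h k : ℝ → ℝ) (Ψ H : ℝ → ℝ → ℝ) : Prop where
  eq : ∀ x, h x = (1 - x ^ 2) * k x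
  contDiff : ContDiff ℝ 2 k
  pos : ∀ x, x ^ 2 ≤ 1 → 0 < 1 + h x
  rotation : ∀ R φ, HasDerivAt (fun φ => Ψ R (sin φ)) (sin R * k (cos R * cos φ)) φ
  delay : ∀ R φ, HasDerivAt (fun φ => H R (sin φ)) (h (cos R * cos φ)) φ
  rotation_zero : ∀ R, Ψ R 0 = 0
  continuous_delay : ∀ R, Continuous (H R)

namespace IsZollProfile

variable {h k : ℝ → ℝ} {Ψ H : ℝ → ℝ → ℝ}

/-- The singular coefficient `h (2 + h) / (1 - z²)` equals `k (2 + h)`, which is regular at the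
poles; there the condition on `v` absorbs the default value of the division by zero. -/
theorem zollMetric_eq (P : IsZollProfile h k Ψ H) {p v : Fin 3 → ℝ} (w : Fin 3 → ℝ)
    (hv : p 2 ^ 2 = 1 → v 2 = 0) :
    zollMetric h p v w = v ⬝ᵥ w + k (p 2) * (2 + h (p 2)) * (v 2 * w 2) := by
  unfold zollMetric
  by_cases hp : p 2 ^ 2 = 1
  · simp [hv hp]
  · have : 1 - p 2 ^ 2 ≠ 0 := fun h' => hp (by linarith)
    rw [P.eq]
    field_simp

theorem hasDerivAt_quotient (P : IsZollProfile h k Ψ H) (x : ℝ) :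
    HasDerivAt k (deriv k x) x :=
  ((P.contDiff.differentiable (by norm_num)) x).hasDerivAt

theorem hasDerivAt (P : IsZollProfile h k Ψ H) (x : ℝ) :
    HasDerivAt h (-(2 * x) * k x + (1 - x ^ 2) * deriv k x) x := by
  have h1 : HasDerivAt (fun S : ℝ => 1 - S ^ 2) (-(2 * x)) x := by
    simpa using (hasDerivAt_pow 2 x).const_sub 1
  rw [funext P.eq]
  exact h1.mul (P.hasDerivAt_quotient x)

theorem contDiff_self (P : IsZollProfile h k Ψ H) : ContDiff ℝ 2 h := by
  rw [funext P.eq]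
  have := P.contDiff
  fun_prop

theorem cos_mul_cos_sq_le (R φ : ℝ) : (cos R * cos φ) ^ 2 ≤ 1 := by
  rw [mul_pow]
  exact mul_le_one₀ (cos_sq_le_one R) (sq_nonneg _) (cos_sq_le_one φ)

end IsZollProfile

theorem hasDerivAt_apply {γ : ℝ → Fin 3 → ℝ} (hγ : ContDiff ℝ 2 γ) (t : ℝ) (i : Fin 3) :
    HasDerivAt (fun s => γ s i) (deriv γ t i) t :=
  hasDerivAt_pi.1 ((hγ.differentiable (by norm_num)) t).hasDerivAt i

theorem hasDerivAt_deriv_apply {γ : ℝ → Fin 3 → ℝ} (hγ : ContDiff ℝ 2 γ) (t : ℝ) (i : Fin 3) :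
    HasDerivAt (fun s => deriv γ s i) (deriv (deriv γ) t i) t := by
  have h1 : ContDiff ℝ 1 (deriv γ) := ((contDiff_succ_iff_deriv (n := 1)).1 hγ).2.2
  exact hasDerivAt_pi.1 ((h1.differentiable (by norm_num)) t).hasDerivAt i

namespace IsZollProfile

variable {h k : ℝ → ℝ} {Ψ H : ℝ → ℝ → ℝ}

/-- The Euler-Lagrange equation of the energy, written out. -/
theorem euler_lagrange_iff (P : IsZollProfile h k Ψ H) {γ : ℝ → Fin 3 → ℝ} (hγ : ContDiff ℝ 2 γ)
    {t : ℝ} (ht : γ t 2 ^ 2 ≠ 1) (w : Fin 3 → ℝ) :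
    deriv (fun s => zollMetric h (γ s) (deriv γ s) w) t =
      1 / 2 * deriv (fun s : ℝ => zollMetric h (γ t + s • w) (deriv γ t) (deriv γ t)) 0 ↔
    deriv (deriv γ) t ⬝ᵥ w +
      (1 / 2 * deriv (fun x => k x * (2 + h x)) (γ t 2) * deriv γ t 2 ^ 2 +
        k (γ t 2) * (2 + h (γ t 2)) * deriv (deriv γ) t 2) * w 2 = 0 := by
  have hq : ∀ x, HasDerivAt (fun x => k x * (2 + h x)) (deriv (fun x => k x * (2 + h x)) x) x :=
    fun x => (((P.hasDerivAt_quotient x).mul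
      ((P.hasDerivAt x).const_add 2)).differentiableAt).hasDerivAt
  have hz := hasDerivAt_apply hγ t
  have hz' := hasDerivAt_deriv_apply hγ t
  have e1 : (fun s => zollMetric h (γ s) (deriv γ s) w) =ᶠ[𝓝 t] fun s =>
      deriv γ s 0 * w 0 + deriv γ s 1 * w 1 + deriv γ s 2 * w 2 +
        k (γ s 2) * (2 + h (γ s 2)) * (deriv γ s 2 * w 2) := by
    have : ∀ᶠ s in 𝓝 t, γ s 2 ^ 2 ≠ 1 :=
      ((hz 2).continuousAt.pow 2).eventually_ne ht
    filter_upwards [this] with s hs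
    rw [P.zollMetric_eq w fun hs' => absurd hs' hs]
    simp [dotProduct, Fin.sum_univ_three]
  have e2 : (fun s : ℝ => zollMetric h (γ t + s • w) (deriv γ t) (deriv γ t)) =ᶠ[𝓝 0] fun s =>
      deriv γ t ⬝ᵥ deriv γ t + k (γ t 2 + s * w 2) * (2 + h (γ t 2 + s * w 2)) *
        (deriv γ t 2 * deriv γ t 2) := by
    have : ∀ᶠ s in 𝓝 (0 : ℝ), (γ t 2 + s * w 2) ^ 2 ≠ 1 := by
      refine ContinuousAt.eventually_ne (by fun_prop) (by simpa using ht)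
    filter_upwards [this] with s hs
    rw [P.zollMetric_eq _ fun hs' => absurd hs' (by simpa using hs)]
    simp
  have d1 := ((((((hz' 0).mul_const (w 0)).fun_add ((hz' 1).mul_const (w 1))).fun_add
    ((hz' 2).mul_const (w 2))).fun_add (((hq (γ t 2)).comp t (hz 2)).fun_mul
    ((hz' 2).mul_const (w 2)))).congr_of_eventuallyEq e1).deriv
  have hl : HasDerivAt (fun s : ℝ => γ t 2 + s * w 2) (w 2) 0 := by
    simpa using ((hasDerivAt_id (0 : ℝ)).mul_const (w 2)).const_add (γ t 2)
  have hq' := hq (γ t 2 + 0 * w 2)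
  have d2 := ((((hq'.comp (0 : ℝ) hl).mul_const
    (deriv γ t 2 * deriv γ t 2)).const_add (deriv γ t ⬝ᵥ deriv γ t)).congr_of_eventuallyEq e2).deriv
  rw [d1, d2]
  simp only [zero_mul, add_zero, Function.comp_apply, dotProduct, Fin.sum_univ_three]
  constructor <;> intro he <;> linear_combination he

theorem deriv_metric_coefficient (P : IsZollProfile h k Ψ H) (x : ℝ) :
    (1 - x ^ 2) * deriv (fun x => k x * (2 + h x)) x =
      2 * (1 + h x) * deriv h x + 2 * x * (k x * (2 + h x)) := by
  rw [((P.hasDerivAt_quotient x).fun_mul ((P.hasDerivAt x).const_add 2)).deriv,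
    (P.hasDerivAt x).deriv, P.eq]
  ring

/-- Away from the poles the Euler-Lagrange equation amounts to the equation of the height and to
the conservation of the angular momentum. -/
theorem euler_lagrange_of_height (P : IsZollProfile h k Ψ H) {γ : ℝ → Fin 3 → ℝ}
    (hγ : ContDiff ℝ 2 γ) {t : ℝ} (ht : γ t 2 ^ 2 ≠ 1) (hs : γ t ⬝ᵥ γ t = 1)
    (hs2 : deriv γ t ⬝ᵥ deriv γ t + γ t ⬝ᵥ deriv (deriv γ) t = 0)
    (hu : zollMetric h (γ t) (deriv γ t) (deriv γ t) = 1)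
    (ha : γ t 0 * deriv (deriv γ) t 1 - γ t 1 * deriv (deriv γ) t 0 = 0)
    (hz : (1 + h (γ t 2)) ^ 2 * deriv (deriv γ) t 2 +
      (1 + h (γ t 2)) * deriv h (γ t 2) * deriv γ t 2 ^ 2 + γ t 2 = 0)
    (w : Fin 3 → ℝ) (hw : γ t ⬝ᵥ w = 0) :
    deriv (fun s => zollMetric h (γ s) (deriv γ s) w) t =
      1 / 2 * deriv (fun s : ℝ => zollMetric h (γ t + s • w) (deriv γ t) (deriv γ t)) 0 := by
  rw [P.euler_lagrange_iff hγ ht]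
  rw [P.zollMetric_eq _ fun hs' => absurd hs' ht] at hu
  have hq := P.deriv_metric_coefficient (γ t 2)
  have he := P.eq (γ t 2)
  generalize deriv (fun x => k x * (2 + h x)) (γ t 2) = q' at *
  generalize h (γ t 2) = h0, deriv h (γ t 2) = h1, k (γ t 2) = k0 at *
  simp only [dotProduct, Fin.sum_univ_three] at *
  generalize deriv (deriv γ) t 0 = x2, deriv (deriv γ) t 1 = y2, deriv (deriv γ) t 2 = z2,
    deriv γ t 0 = x1, deriv γ t 1 = y1, deriv γ t 2 = z1, γ t 0 = x, γ t 1 = y,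
    γ t 2 = z at *
  have hN : 1 - z ^ 2 ≠ 0 := fun h' => ht (by linarith)
  -- The factor `1 - z² = x² + y²` lets the test vector split into its angular and vertical parts,
  -- with no division.
  refine (mul_eq_zero.1 ?_).resolve_left hN
  linear_combination (x * w 1 - y * w 0) * ha + w 2 * (hz - z * hs2 + z * hu +
    1 / 2 * z1 ^ 2 * hq - (2 + h0) * z2 * he) + x2 * (x * hw - w 0 * hs) +
    y2 * (y * hw - w 1 * hs)

theorem height_of_euler_lagrange (P : IsZollProfile h k Ψ H) {γ : ℝ → Fin 3 → ℝ}
    (hγ : ContDiff ℝ 2 γ) {t : ℝ} (ht : γ t 2 ^ 2 ≠ 1) (hs : γ t ⬝ᵥ γ t = 1)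
    (hs2 : deriv γ t ⬝ᵥ deriv γ t + γ t ⬝ᵥ deriv (deriv γ) t = 0)
    (hu : zollMetric h (γ t) (deriv γ t) (deriv γ t) = 1)
    (hel : ∀ w : Fin 3 → ℝ, γ t ⬝ᵥ w = 0 →
      deriv (fun s => zollMetric h (γ s) (deriv γ s) w) t =
        1 / 2 * deriv (fun s : ℝ => zollMetric h (γ t + s • w) (deriv γ t) (deriv γ t)) 0) :
    γ t 0 * deriv (deriv γ) t 1 - γ t 1 * deriv (deriv γ) t 0 = 0 ∧
    (1 + h (γ t 2)) ^ 2 * deriv (deriv γ) t 2 +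
      (1 + h (γ t 2)) * deriv h (γ t 2) * deriv γ t 2 ^ 2 + γ t 2 = 0 := by
  -- The rotation field `∂/∂θ` as test vector yields conservation of the angular momentum.
  have h1 := (P.euler_lagrange_iff hγ ht _).1 (hel ![-γ t 1, γ t 0, 0] (by
    simp [dotProduct, Fin.sum_univ_three]; ring))
  -- The tangential projection of the vertical axis yields the height equation.
  have h2 := (P.euler_lagrange_iff hγ ht _).1
    (hel ![-(γ t 0 * γ t 2), -(γ t 1 * γ t 2), 1 - γ t 2 ^ 2] (by
      simp only [dotProduct, Fin.sum_univ_three] at hs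
      simp [dotProduct, Fin.sum_univ_three]; linear_combination -γ t 2 * hs))
  rw [P.zollMetric_eq _ fun hs' => absurd hs' ht] at hu
  have hq := P.deriv_metric_coefficient (γ t 2)
  have he := P.eq (γ t 2)
  simp only [dotProduct, Fin.sum_univ_three, Matrix.cons_val, Matrix.cons_val_zero,
    Matrix.cons_val_one] at *
  generalize deriv (fun x => k x * (2 + h x)) (γ t 2) = q' at *
  generalize h (γ t 2) = h0, deriv h (γ t 2) = h1, k (γ t 2) = k0 at *
  generalize deriv (deriv γ) t 0 = x2, deriv (deriv γ) t 1 = y2, deriv (deriv γ) t 2 = z2,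
    deriv γ t 0 = x1, deriv γ t 1 = y1, deriv γ t 2 = z1, γ t 0 = x, γ t 1 = y,
    γ t 2 = z at *
  refine ⟨by linear_combination h1, ?_⟩
  linear_combination h2 + z * hs2 - z * hu - 1 / 2 * z1 ^ 2 * hq + (2 + h0) * z2 * he

end IsZollProfile

/-! ### The candidate geodesics: position, velocity, normal -/

/-- The point of colatitude with cosine `cos R * cos φ` obtained by rotating a great circle, of
nearest colatitude `R`, by the angle `β`. -/
noncomputable def phasePoint (β R φ : ℝ) : Fin 3 → ℝ :=
  ![cos β * (cos φ * sin R) - sin β * sin φ, sin β * (cos φ * sin R) + cos β * sin φ,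
    cos R * cos φ]

/-- The unit velocity at `phasePoint β R φ` of the geodesic with nearest colatitude `R`. -/
noncomputable def phaseVelocity (h k : ℝ → ℝ) (β R φ : ℝ) : Fin 3 → ℝ :=
  (1 + h (cos R * cos φ))⁻¹ •
    ![-(cos β * (sin φ * sin R)) - sin β * cos φ -
        sin R * k (cos R * cos φ) * phasePoint β R φ 1,
      -(sin β * (sin φ * sin R)) + cos β * cos φ +
        sin R * k (cos R * cos φ) * phasePoint β R φ 0,
      -(cos R * sin φ)]

/-- The positive unit normal of `phaseVelocity h k β R φ`. -/
noncomputable def phaseNormal (h k : ℝ → ℝ) (β R φ : ℝ) : Fin 3 → ℝ :=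
  (1 + h (cos R * cos φ))⁻¹ •
    ![cos R * (-(1 + h (cos R * cos φ)) * cos β +
        sin R * cos φ * k (cos R * cos φ) * phasePoint β R φ 0),
      cos R * (-(1 + h (cos R * cos φ)) * sin β +
        sin R * cos φ * k (cos R * cos φ) * phasePoint β R φ 1),
      sin R]

namespace IsZollProfile

variable {h k : ℝ → ℝ} {Ψ H : ℝ → ℝ → ℝ}

theorem phase_pos (P : IsZollProfile h k Ψ H) (R φ : ℝ) : 0 < 1 + h (cos R * cos φ) :=
  P.pos _ (cos_mul_cos_sq_le R φ)

/-- Only meridians (`sin R = 0`) reach a pole; there the candidate velocity and normal are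
horizontal, as `zollMetric_eq` requires. -/
theorem phase_pole {R φ : ℝ} (hp : (cos R * cos φ) ^ 2 = 1) : cos R * sin φ = 0 ∧ sin R = 0 := by
  have h1 := sin_sq_add_cos_sq R
  have h2 := sin_sq_add_cos_sq φ
  have h3 : cos R ^ 2 * sin φ ^ 2 = cos R ^ 2 - 1 := by
    linear_combination cos R ^ 2 * h2 - hp
  constructor <;> refine pow_eq_zero_iff two_ne_zero |>.1 (le_antisymm ?_ (sq_nonneg _))
  · nlinarith [sq_nonneg (sin R)]
  · nlinarith [sq_nonneg (cos R * sin φ)]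

theorem isUnitTangent_phase (P : IsZollProfile h k Ψ H) (β R φ : ℝ) :
    IsUnitTangent h (phasePoint β R φ) (phaseVelocity h k β R φ) := by
  have hpos := (P.phase_pos R φ).ne'
  have h1 := sin_sq_add_cos_sq R
  have h2 := sin_sq_add_cos_sq φ
  have h3 := sin_sq_add_cos_sq β
  have he := P.eq (cos R * cos φ)
  refine ⟨?_, ?_, ?_⟩
  · simp [phasePoint, dotProduct, Fin.sum_univ_three]
    grind
  · simp [phasePoint, phaseVelocity, dotProduct, Fin.sum_univ_three]
    generalize h (cos R * cos φ) = h0, k (cos R * cos φ) = k0 at *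
    field_simp
    grind
  · rw [P.zollMetric_eq _ fun hp => ?_]
    · simp [phasePoint, phaseVelocity, dotProduct, Fin.sum_univ_three]
      generalize h (cos R * cos φ) = h0, k (cos R * cos φ) = k0 at *
      field_simp
      grind
    · simp [phasePoint, phaseVelocity] at ⊢
      have := (phase_pole hp).1
      simp_all

theorem isUnitNormal_phase (P : IsZollProfile h k Ψ H) (β R φ : ℝ) :
    IsUnitNormal h (phasePoint β R φ) (phaseVelocity h k β R φ) (phaseNormal h k β R φ) := by
  have hpos := (P.phase_pos R φ).ne'
  have h1 := sin_sq_add_cos_sq R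
  have h2 := sin_sq_add_cos_sq φ
  have h3 := sin_sq_add_cos_sq β
  have he := P.eq (cos R * cos φ)
  refine ⟨?_, ?_, ?_, ?_⟩
  · simp [phasePoint, phaseNormal, dotProduct, Fin.sum_univ_three]
    generalize h (cos R * cos φ) = h0, k (cos R * cos φ) = k0 at *
    field_simp
    grind
  · rw [P.zollMetric_eq _ fun hp => ?_]
    · simp [phasePoint, phaseNormal, dotProduct, Fin.sum_univ_three]
      generalize h (cos R * cos φ) = h0, k (cos R * cos φ) = k0 at *
      field_simp
      grind
    · simp [phasePoint, phaseNormal] at ⊢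
      have := (phase_pole hp).2
      simp_all
  · rw [P.zollMetric_eq _ fun hp => ?_]
    · simp [phasePoint, phaseVelocity, phaseNormal, dotProduct, Fin.sum_univ_three]
      generalize h (cos R * cos φ) = h0, k (cos R * cos φ) = k0 at *
      field_simp
      grind
    · simp [phasePoint, phaseVelocity] at ⊢
      have := (phase_pole hp).1
      simp_all
  · have : phasePoint β R φ ⬝ᵥ (phaseVelocity h k β R φ ⨯₃ phaseNormal h k β R φ) =
        (1 + h (cos R * cos φ))⁻¹ := by
      simp [phasePoint, phaseVelocity, phaseNormal, dotProduct, Fin.sum_univ_three, crossProduct]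
      generalize h (cos R * cos φ) = h0, k (cos R * cos φ) = k0 at *
      field_simp
      grind
    rw [this]
    exact inv_pos.2 (P.phase_pos R φ)

end IsZollProfile

/-! ### The candidate curves are geodesics -/

namespace IsZollProfile

variable {h k : ℝ → ℝ} {Ψ H : ℝ → ℝ → ℝ}

/-- The phase of a geodesic as a function of the time. -/
theorem exists_phase (P : IsZollProfile h k Ψ H) (R φ₀ : ℝ) :
    ∃ φ : ℝ → ℝ, φ 0 = φ₀ ∧ (∃ t, φ t = 0) ∧
      ∀ t, HasDerivAt φ (1 + h (cos R * cos (φ t)))⁻¹ t := by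
  -- `T` is the time as a function of the phase. It is strictly increasing, and onto since the delay
  -- is bounded; the phase is its inverse, shifted to start at `φ₀`.
  set T : ℝ → ℝ := fun φ => φ + H R (sin φ) with hT
  have hd : ∀ φ, HasDerivAt T (1 + h (cos R * cos φ)) φ := fun φ =>
    (hasDerivAt_id φ).add (P.delay R φ)
  have hc : Continuous T := continuous_iff_continuousAt.2 fun φ => (hd φ).continuousAt
  have hm : StrictMono T := strictMono_of_deriv_pos fun φ => by
    rw [(hd φ).deriv]; exact P.phase_pos R φ
  obtain ⟨B, hB⟩ := (isCompact_Icc (a := (-1 : ℝ)) (b := 1)).exists_bound_of_continuousOn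
    (P.continuous_delay R).continuousOn
  have hB' : ∀ φ, -B ≤ H R (sin φ) ∧ H R (sin φ) ≤ B := fun φ =>
    abs_le.1 (hB (sin φ) ⟨neg_one_le_sin φ, sin_le_one φ⟩)
  have hs : Function.Surjective T := hc.surjective
    (Filter.tendsto_atTop_mono (fun φ => by linarith [(hB' φ).1] : ∀ φ, φ + -B ≤ T φ)
      (Filter.tendsto_atTop_add_const_right _ _ Filter.tendsto_id))
    (Filter.tendsto_atBot_mono (fun φ => by linarith [(hB' φ).2] : ∀ φ, T φ ≤ φ + B)
      (Filter.tendsto_atBot_add_const_right _ _ Filter.tendsto_id))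
  set e := hm.orderIsoOfSurjective T hs
  have he : ∀ φ, e φ = T φ := fun φ => rfl
  refine ⟨fun t => e.symm (t + T φ₀), ?_, ⟨T 0 - T φ₀, ?_⟩, fun t => ?_⟩
  · simp [← he]
  · simp [← he]
  · have h1 : HasDerivAt (fun s => s + T φ₀) 1 t := (hasDerivAt_id t).add_const _
    have h2 := HasDerivAt.of_local_left_inverse (f := T) (g := e.symm) (a := t + T φ₀)
      e.symm.continuous.continuousAt (hd _) (P.phase_pos R _).ne'
      (Filter.Eventually.of_forall fun y => by rw [← he]; simp)
    exact (h2.comp t h1).congr_deriv (mul_one _)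

theorem hasDerivAt_phasePoint {β φ : ℝ → ℝ} {β' φ' t : ℝ} (R : ℝ) (hβ : HasDerivAt β β' t)
    (hφ : HasDerivAt φ φ' t) :
    HasDerivAt (fun t => phasePoint (β t) R (φ t))
      ![φ' * (-(cos (β t) * (sin (φ t) * sin R)) - sin (β t) * cos (φ t)) -
          β' * phasePoint (β t) R (φ t) 1,
        φ' * (-(sin (β t) * (sin (φ t) * sin R)) + cos (β t) * cos (φ t)) +
          β' * phasePoint (β t) R (φ t) 0,
        -(φ' * (cos R * sin (φ t)))] t := by
  rw [hasDerivAt_pi]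
  intro i
  fin_cases i
  · refine ((hβ.cos.fun_mul (hφ.cos.mul_const (sin R))).fun_sub
      (hβ.sin.fun_mul hφ.sin)).congr_deriv ?_
    simp [phasePoint]
    ring
  · refine ((hβ.sin.fun_mul (hφ.cos.mul_const (sin R))).fun_add
      (hβ.cos.fun_mul hφ.sin)).congr_deriv ?_
    simp [phasePoint]
    ring
  · refine (hφ.cos.const_mul (cos R)).congr_deriv ?_
    simp
    ring

theorem hasDerivAt_phasePoint_geodesic (P : IsZollProfile h k Ψ H) (R Θ : ℝ) {φ : ℝ → ℝ} {t : ℝ}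
    (hφ : HasDerivAt φ (1 + h (cos R * cos (φ t)))⁻¹ t) :
    HasDerivAt (fun t => phasePoint (Θ + Ψ R (sin (φ t))) R (φ t))
      (phaseVelocity h k (Θ + Ψ R (sin (φ t))) R (φ t)) t := by
  have hβ := ((P.rotation R (φ t)).comp t hφ).const_add Θ
  refine (hasDerivAt_phasePoint R hβ hφ).congr_deriv ?_
  ext i
  fin_cases i <;> simp [phaseVelocity] <;> ring

theorem contDiff_phase (P : IsZollProfile h k Ψ H) (R : ℝ) {φ : ℝ → ℝ}
    (hφ : ∀ t, HasDerivAt φ (1 + h (cos R * cos (φ t)))⁻¹ t) : ContDiff ℝ 2 φ := by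
  have hd : deriv φ = fun t => (1 + h (cos R * cos (φ t)))⁻¹ := funext fun t => (hφ t).deriv
  have hdiff : Differentiable ℝ φ := fun t => (hφ t).differentiableAt
  have hne : ∀ t, 1 + h (cos R * cos (φ t)) ≠ 0 := fun t => (P.phase_pos R (φ t)).ne'
  have hh := P.contDiff_self
  have h1 : ContDiff ℝ 1 φ := by
    rw [show (1 : WithTop ℕ∞) = 0 + 1 by norm_num, contDiff_succ_iff_deriv]
    refine ⟨hdiff, by simp, ?_⟩
    rw [hd, contDiff_zero]
    exact Continuous.inv₀ (by have := hdiff.continuous; have := hh.continuous; fun_prop) hne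
  rw [show (2 : WithTop ℕ∞) = 1 + 1 by norm_num, contDiff_succ_iff_deriv]
  refine ⟨hdiff, by simp, ?_⟩
  rw [hd]
  refine ContDiff.inv ?_ hne
  have : ContDiff ℝ 1 h := hh.of_le (by norm_num)
  fun_prop

theorem contDiff_rotation (P : IsZollProfile h k Ψ H) (R : ℝ) :
    ContDiff ℝ 2 fun φ => Ψ R (sin φ) := by
  rw [show (2 : WithTop ℕ∞) = 1 + 1 by norm_num, contDiff_succ_iff_deriv]
  refine ⟨fun φ => (P.rotation R φ).differentiableAt, by simp, ?_⟩
  rw [funext fun φ => (P.rotation R φ).deriv]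
  have : ContDiff ℝ 1 k := P.contDiff.of_le (by norm_num)
  fun_prop

theorem isUnitGeodesic_phase (P : IsZollProfile h k Ψ H) (R Θ : ℝ) {φ : ℝ → ℝ}
    (hφ : ∀ t, HasDerivAt φ (1 + h (cos R * cos (φ t)))⁻¹ t) :
    IsUnitGeodesic h fun t => phasePoint (Θ + Ψ R (sin (φ t))) R (φ t) := by
  set γ : ℝ → Fin 3 → ℝ := fun t => phasePoint (Θ + Ψ R (sin (φ t))) R (φ t) with hγ
  have hd : ∀ t, deriv γ t = phaseVelocity h k (Θ + Ψ R (sin (φ t))) R (φ t) := fun t =>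
    (P.hasDerivAt_phasePoint_geodesic R Θ (hφ t)).deriv
  have hT := fun t => P.isUnitTangent_phase (Θ + Ψ R (sin (φ t))) R (φ t)
  have hcd : ContDiff ℝ 2 γ := by
    have h1 := P.contDiff_phase R hφ
    have h2 : ∀ ψ : ℝ → ℝ, ContDiff ℝ 2 ψ →
        ContDiff ℝ 2 fun t => phasePoint (Θ + ψ t) R (φ t) := fun ψ hψ => by
      rw [contDiff_pi]
      intro i
      fin_cases i <;> simp only [phasePoint] <;> simp <;> fun_prop
    exact h2 _ ((P.contDiff_rotation R).comp h1)
  refine ⟨hcd, fun t => (hT t).mem_sphere, fun t => ?_, fun t ht w hw => ?_⟩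
  · rw [hd]
    exact (hT t).unit
  have hz := hasDerivAt_apply hcd t
  have hz' := hasDerivAt_deriv_apply hcd t
  have hne := fun t => (P.phase_pos R (φ t)).ne'
  have htan : ∀ t, γ t 0 * deriv γ t 0 + γ t 1 * deriv γ t 1 + γ t 2 * deriv γ t 2 = 0 := fun t => by
    have := (hT t).tangent
    rw [← hd] at this
    simpa [dotProduct, Fin.sum_univ_three] using this
  have hang : ∀ t, γ t 0 * deriv γ t 1 - γ t 1 * deriv γ t 0 = sin R := fun t => by
    rw [hd]
    have h1 := sin_sq_add_cos_sq R
    have h2 := sin_sq_add_cos_sq (φ t)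
    have h3 := sin_sq_add_cos_sq (Θ + Ψ R (sin (φ t)))
    have he := P.eq (cos R * cos (φ t))
    have hn := hne t
    simp [hγ, phasePoint, phaseVelocity]
    generalize h (cos R * cos (φ t)) = h0, k (cos R * cos (φ t)) = k0,
      Θ + Ψ R (sin (φ t)) = β at *
    field_simp
    grind
  have hheight : ∀ t, (1 + h (γ t 2)) * deriv γ t 2 = -(cos R * sin (φ t)) := fun t => by
    rw [hd]
    have hn := hne t
    simp [hγ, phasePoint, phaseVelocity]
    field_simp
  -- Each remaining condition is the derivative of an identity along the curve: tangency, constant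
  -- angular momentum, `(1 + h z) z' = -cos R * sin φ`.
  refine P.euler_lagrange_of_height hcd ht (hT t).mem_sphere ?_ ?_ ?_ ?_ w hw
  · have h1 := (((hz 0).fun_mul (hz' 0)).fun_add ((hz 1).fun_mul (hz' 1))).fun_add
      ((hz 2).fun_mul (hz' 2))
    rw [funext htan] at h1
    have := h1.unique (hasDerivAt_const t 0)
    simp only [dotProduct, Fin.sum_univ_three]
    linear_combination this
  · rw [hd]
    exact (hT t).unit
  · have h1 := ((hz 0).fun_mul (hz' 1)).fun_sub ((hz 1).fun_mul (hz' 0))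
    rw [funext hang] at h1
    have := h1.unique (hasDerivAt_const t _)
    linear_combination this
  · have hh : HasDerivAt h (deriv h (γ t 2)) (γ t 2) := (P.hasDerivAt _).differentiableAt.hasDerivAt
    have h1 := ((hh.comp t (hz 2)).const_add 1).fun_mul (hz' 2)
    simp only [Function.comp_apply] at h1
    rw [funext hheight] at h1
    have h2 := h1.unique ((hφ t).sin.const_mul (cos R)).fun_neg
    have h3 : γ t 2 = cos R * cos (φ t) := rfl
    have hn := hne t
    rw [← h3] at h2 hn
    field_simp at h2
    linear_combination h2 + h3

end IsZollProfile

/-! ### The phase of a unit tangent vector -/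

/-- The unit tangent vector `u` at `p` has phase `φ` on the geodesic with coordinates `(R, Θ)`. -/
structure HasPhase (h k : ℝ → ℝ) (Ψ : ℝ → ℝ → ℝ) (p u : Fin 3 → ℝ) (R Θ φ : ℝ) : Prop where
  angular : p 0 * u 1 - p 1 * u 0 = sin R
  height : p 2 = cos R * cos φ
  speed : (1 + h (p 2)) * u 2 = -(cos R * sin φ)
  fst : sin φ * p 0 + cos φ * ((1 + h (p 2)) * u 0 + sin R * k (p 2) * p 1) =
    -sin (Θ + Ψ R (sin φ))
  snd : sin φ * p 1 + cos φ * ((1 + h (p 2)) * u 1 - sin R * k (p 2) * p 0) =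
    cos (Θ + Ψ R (sin φ))

theorem eq_zero_of_sq_eq_one {p : Fin 3 → ℝ} (hs : p ⬝ᵥ p = 1) (hp : p 2 ^ 2 = 1) :
    p 0 = 0 ∧ p 1 = 0 := by
  simp only [dotProduct, Fin.sum_univ_three] at hs
  constructor <;> nlinarith [sq_nonneg (p 0), sq_nonneg (p 1)]

theorem sq_le_one_of_sphere {p : Fin 3 → ℝ} (hs : p ⬝ᵥ p = 1) : p 2 ^ 2 ≤ 1 := by
  simp only [dotProduct, Fin.sum_univ_three] at hs
  nlinarith [sq_nonneg (p 0), sq_nonneg (p 1)]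

theorem tangent_pole {p u : Fin 3 → ℝ} (hs : p ⬝ᵥ p = 1) (ht : p ⬝ᵥ u = 0) (hp : p 2 ^ 2 = 1) :
    u 2 = 0 := by
  obtain ⟨h0, h1⟩ := eq_zero_of_sq_eq_one hs hp
  simp only [dotProduct, Fin.sum_univ_three, h0, h1] at ht
  have : p 2 ≠ 0 := fun h' => by simp [h'] at hp
  simp_all

namespace IsZollProfile

variable {h k : ℝ → ℝ} {Ψ H : ℝ → ℝ → ℝ}

theorem zollMetric_tangent (P : IsZollProfile h k Ψ H) {p v : Fin 3 → ℝ} (hs : p ⬝ᵥ p = 1)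
    (hv : p ⬝ᵥ v = 0) (w : Fin 3 → ℝ) :
    zollMetric h p v w = v 0 * w 0 + v 1 * w 1 + v 2 * w 2 +
      k (p 2) * (2 + h (p 2)) * (v 2 * w 2) := by
  rw [P.zollMetric_eq w (tangent_pole hs hv)]
  simp [dotProduct, Fin.sum_univ_three]

/-- Clairaut's relation. -/
theorem clairaut (P : IsZollProfile h k Ψ H) {p u : Fin 3 → ℝ} (hu : IsUnitTangent h p u) :
    ((1 + h (p 2)) * u 2) ^ 2 = 1 - p 2 ^ 2 - (p 0 * u 1 - p 1 * u 0) ^ 2 := by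
  have h1 := hu.unit
  rw [P.zollMetric_tangent hu.mem_sphere hu.tangent] at h1
  have h2 := hu.mem_sphere
  have h3 := hu.tangent
  have he := P.eq (p 2)
  simp only [dotProduct, Fin.sum_univ_three] at h2 h3
  generalize h (p 2) = h0, k (p 2) = k0, p 0 = x, p 1 = y, p 2 = z, u 0 = x1, u 1 = y1,
    u 2 = z1 at *
  grind

theorem hasPhase_phase (P : IsZollProfile h k Ψ H) (R Θ φ : ℝ) :
    HasPhase h k Ψ (phasePoint (Θ + Ψ R (sin φ)) R φ)
      (phaseVelocity h k (Θ + Ψ R (sin φ)) R φ) R Θ φ := by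
  have h1 := sin_sq_add_cos_sq R
  have h2 := sin_sq_add_cos_sq φ
  have he := P.eq (cos R * cos φ)
  have hn := (P.phase_pos R φ).ne'
  constructor
  · have h3 := sin_sq_add_cos_sq (Θ + Ψ R (sin φ))
    simp [phasePoint, phaseVelocity]
    generalize h (cos R * cos φ) = h0, k (cos R * cos φ) = k0, Θ + Ψ R (sin φ) = β at *
    field_simp
    grind
  · rfl
  · simp [phasePoint, phaseVelocity]
    field_simp
  · simp [phasePoint, phaseVelocity]
    generalize h (cos R * cos φ) = h0, k (cos R * cos φ) = k0, Θ + Ψ R (sin φ) = β at *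
    field_simp
    linear_combination -sin β * h2
  · simp [phasePoint, phaseVelocity]
    generalize h (cos R * cos φ) = h0, k (cos R * cos φ) = k0, Θ + Ψ R (sin φ) = β at *
    field_simp
    linear_combination cos β * h2

/-- The vector in the last two fields of `HasPhase` is `(-sin β, cos β)`, the horizontal direction
in the plane of the rotated great circle. With height, speed and angular momentum it determines
point and velocity. -/
theorem eq_phase (P : IsZollProfile h k Ψ H) {p u : Fin 3 → ℝ} {R Θ φ : ℝ}
    (hu : IsUnitTangent h p u) (hφ : HasPhase h k Ψ p u R Θ φ) :
    p = phasePoint (Θ + Ψ R (sin φ)) R φ ∧ u = phaseVelocity h k (Θ + Ψ R (sin φ)) R φ := by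
  have h1 := sin_sq_add_cos_sq R
  have h2 := sin_sq_add_cos_sq φ
  obtain ⟨h3, h4, h5, h6, h7⟩ := hφ
  have he := P.eq (p 2)
  have hn := (P.pos (p 2) (sq_le_one_of_sphere hu.mem_sphere)).ne'
  have hs := hu.mem_sphere
  have ht := hu.tangent
  have hpole' := eq_zero_of_sq_eq_one hs
  simp only [dotProduct, Fin.sum_univ_three] at hs ht
  have hp0 : p 0 = phasePoint (Θ + Ψ R (sin φ)) R φ 0 ∧
      p 1 = phasePoint (Θ + Ψ R (sin φ)) R φ 1 ∧
      (1 + h (p 2)) * u 0 = -(cos (Θ + Ψ R (sin φ)) * (sin φ * sin R)) -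
        sin (Θ + Ψ R (sin φ)) * cos φ - sin R * k (p 2) * p 1 ∧
      (1 + h (p 2)) * u 1 = -(sin (Θ + Ψ R (sin φ)) * (sin φ * sin R)) +
        cos (Θ + Ψ R (sin φ)) * cos φ + sin R * k (p 2) * p 0 := by
    rw [neg_eq_iff_eq_neg.symm] at h6
    simp only [phasePoint, Matrix.cons_val, ← h6, ← h7]
    clear h6 h7 hu
    by_cases hp : p 2 ^ 2 = 1
    · obtain ⟨hx, hy⟩ := hpole' hp
      rw [h4] at hp
      have hc := (phase_pole hp).2
      have hsφ : sin φ = 0 := by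
        have := (phase_pole hp).1
        rcases mul_eq_zero.1 this with h' | h'
        · simp [h'] at hp
        · exact h'
      rw [hsφ] at h2
      simp only [hx, hy, hc, hsφ]
      refine ⟨by ring, by ring, ?_, ?_⟩
      · linear_combination -(1 + h (p 2)) * u 0 * h2
      · linear_combination -(1 + h (p 2)) * u 1 * h2
    · have hN : 1 - p 2 ^ 2 ≠ 0 := fun h' => hp (by linarith)
      -- Tangency and angular momentum form a linear system for the horizontal velocity, with
      -- determinant `x² + y² = 1 - z²`.
      have hA : (1 - p 2 ^ 2) * ((1 + h (p 2)) * u 0) =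
          p 0 * (cos R ^ 2 * sin φ * cos φ) - (1 + h (p 2)) * p 1 * sin R := by
        linear_combination (1 + h (p 2)) * (p 0 * ht - p 1 * h3 - u 0 * hs) -
          p 0 * p 2 * h5 + p 0 * cos R * sin φ * h4
      have hB : (1 - p 2 ^ 2) * ((1 + h (p 2)) * u 1) =
          p 1 * (cos R ^ 2 * sin φ * cos φ) + (1 + h (p 2)) * p 0 * sin R := by
        linear_combination (1 + h (p 2)) * (p 1 * ht + p 0 * h3 - u 1 * hs) -
          p 1 * p 2 * h5 + p 1 * cos R * sin φ * h4
      clear hpole' hp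
      generalize h (p 2) = h0, k (p 2) = k0 at *
      generalize p 0 = x, p 1 = y, p 2 = z at *
      generalize (1 + h0) * u 0 = A, (1 + h0) * u 1 = B at *
      subst h4 he
      generalize sin φ = s, cos φ = κ, sin R = c, cos R = C at *
      refine ⟨mul_left_cancel₀ hN ?_, mul_left_cancel₀ hN ?_, mul_left_cancel₀ hN ?_,
        mul_left_cancel₀ hN ?_⟩
      · linear_combination -(s * κ) * hA - κ ^ 2 * c * hB - x * κ ^ 2 * h1 -
          x * ((1 - (C * κ) ^ 2) + κ ^ 2 * C ^ 2) * h2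
      · linear_combination -(s * κ) * hB + κ ^ 2 * c * hA - y * κ ^ 2 * h1 -
          y * ((1 - (C * κ) ^ 2) + κ ^ 2 * C ^ 2) * h2
      · linear_combination (1 - κ ^ 2) * hA + s * c * κ * hB + x * s * κ * h1 + y * c * h2
      · linear_combination (1 - κ ^ 2) * hB - s * c * κ * hA + y * s * κ * h1 - x * c * h2
  obtain ⟨hp0, hp1, hu0, hu1⟩ := hp0
  refine ⟨?_, ?_⟩
  · ext i
    fin_cases i
    · exact hp0
    · exact hp1
    · exact h4
  · ext i
    fin_cases i <;> simp [phaseVelocity, ← hp0, ← hp1, ← h4]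
    · rw [eq_inv_mul_iff_mul_eq₀ hn]
      exact hu0
    · rw [eq_inv_mul_iff_mul_eq₀ hn]
      exact hu1
    · field_simp
      linear_combination h5

end IsZollProfile

/-! ### Every geodesic has a phase -/

/-- In the frame turning by `β` the vector `(f, g)` is constant. This replaces a uniqueness theorem
for the geodesic equation. -/
theorem eq_cos_sin_of_rotation {f g β ω : ℝ → ℝ} {r t₀ : ℝ}
    (hf : ∀ t, HasDerivAt f (-(ω t * g t)) t) (hg : ∀ t, HasDerivAt g (ω t * f t) t)
    (hβ : ∀ t, HasDerivAt β (ω t) t) (hf₀ : f t₀ = r * cos (β t₀)) (hg₀ : g t₀ = r * sin (β t₀))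
    (t : ℝ) : f t = r * cos (β t) ∧ g t = r * sin (β t) := by
  have h1 : ∀ t, f t * cos (β t) + g t * sin (β t) = r := fun t => by
    refine eq_of_hasDerivAt_eq (f' := fun _ => 0) (f := fun t => f t * cos (β t) + g t * sin (β t))
      (g := fun _ => r) (fun s => ?_) (fun s => hasDerivAt_const s r) t₀ ?_ t
    · refine (((hf s).fun_mul (hβ s).cos).fun_add ((hg s).fun_mul (hβ s).sin)).congr_deriv ?_
      ring
    · simp only [hf₀, hg₀]
      linear_combination r * sin_sq_add_cos_sq (β t₀)
  have h2 : ∀ t, g t * cos (β t) - f t * sin (β t) = 0 := fun t => by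
    refine eq_of_hasDerivAt_eq (f' := fun _ => 0) (f := fun t => g t * cos (β t) - f t * sin (β t))
      (g := fun _ => 0) (fun s => ?_) (fun s => hasDerivAt_const s 0) t₀ ?_ t
    · refine (((hg s).fun_mul (hβ s).cos).fun_sub ((hf s).fun_mul (hβ s).sin)).congr_deriv ?_
      ring
    · simp only [hf₀, hg₀]
      ring
  have h3 := sin_sq_add_cos_sq (β t)
  constructor
  · linear_combination cos (β t) * h1 t - sin (β t) * h2 t - f t * h3
  · linear_combination sin (β t) * h1 t + cos (β t) * h2 t - g t * h3

theorem horizontal_equation_aux {x y z x1 y1 z1 x2 y2 z2 h0 h1 k0 k1 c : ℝ}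
    (hs : x * x + y * y + z * z = 1) (ht : x * x1 + y * y1 + z * z1 = 0)
    (hs2 : x1 * x1 + y1 * y1 + z1 * z1 + (x * x2 + y * y2 + z * z2) = 0)
    (hu : x1 * x1 + y1 * y1 + z1 * z1 + k0 * (2 + h0) * (z1 * z1) = 1)
    (hc : x * y1 - y * x1 = c) (hc2 : x * y2 - y * x2 = 0)
    (hz2 : (1 + h0) ^ 2 * z2 + (1 + h0) * h1 * z1 ^ 2 + z = 0)
    (hcl : ((1 + h0) * z1) ^ 2 = 1 - z ^ 2 - c ^ 2) (he : h0 = (1 - z ^ 2) * k0)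
    (hd : h1 = -(2 * z) * k0 + (1 - z ^ 2) * k1) :
    (1 - z ^ 2) * ((1 + h0) ^ 2 * x2 + (1 + h0) * (h1 * z1 * x1 + c * k1 * z1 * y + 2 * c * k0 * y1) +
      x * (1 - c ^ 2 * k0 ^ 2)) = 0 := by
  have hx1 : (1 - z ^ 2) * x1 = -(x * z * z1) - y * c := by
    linear_combination x * ht - y * hc - x1 * hs
  have hy1 : (1 - z ^ 2) * y1 = -(y * z * z1) + x * c := by
    linear_combination y * ht + x * hc - y1 * hs
  have hx2 : (1 - z ^ 2) * x2 = -(x * (1 - k0 * (2 + h0) * z1 ^ 2)) - x * z * z2 := by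
    linear_combination x * hs2 - y * hc2 - x2 * hs - x * hu
  linear_combination (1 + h0) ^ 2 * hx2 + (1 + h0) * h1 * z1 * hx1 + 2 * (1 + h0) * c * k0 * hy1 -
    x * z * hz2 + x * k0 * (2 + h0) * hcl - (1 + h0) * c * z1 * y * hd +
    (-(2 + h0) + c ^ 2 * k0) * x * he

namespace IsZollProfile

variable {h k : ℝ → ℝ} {Ψ H : ℝ → ℝ → ℝ}

theorem projectsTo_phase (P : IsZollProfile h k Ψ H) {R : ℝ} (Θ φ₀ : ℝ) (hR₁ : -(π / 2) < R)
    (hR₂ : R < π / 2) :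
    ProjectsTo h (phasePoint (Θ + Ψ R (sin φ₀)) R φ₀)
      (phaseVelocity h k (Θ + Ψ R (sin φ₀)) R φ₀) R Θ := by
  obtain ⟨φ, h0, ⟨t, ht⟩, hφ⟩ := P.exists_phase R φ₀
  have hd := fun t => (P.hasDerivAt_phasePoint_geodesic R Θ (hφ t)).deriv
  refine ⟨_, P.isUnitGeodesic_phase R Θ hφ, by rw [h0], by rw [hd, h0], hR₁, hR₂, t, ?_, ?_⟩
  · simp [ht, P.rotation_zero, phasePoint, spherePoint, mul_comm]
  · rw [hd]
    have hn := (P.phase_pos R 0).ne'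
    have he := P.eq (cos R * cos 0)
    -- At phase `0` the factor `1 + h (cos R)` cancels, because `h (cos R) = sin² R * k (cos R)`.
    have h1 := sin_sq_add_cos_sq R
    simp only [cos_zero, mul_one] at hn he
    ext i
    fin_cases i <;> simp [ht, P.rotation_zero, phasePoint, phaseVelocity]
    · field_simp
      linear_combination sin Θ * (he - k (cos R) * h1)
    · field_simp
      linear_combination -cos Θ * (he - k (cos R) * h1)

end IsZollProfile

namespace IsUnitGeodesic

variable {h k : ℝ → ℝ} {Ψ H : ℝ → ℝ → ℝ} {γ : ℝ → Fin 3 → ℝ}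

theorem isUnitTangent (hγ : IsUnitGeodesic h γ) (t : ℝ) :
    IsUnitTangent h (γ t) (deriv γ t) := by
  refine ⟨hγ.mem_sphere t, ?_, hγ.unit_speed t⟩
  have hz := hasDerivAt_apply hγ.contDiff t
  have h1 := (((hz 0).fun_mul (hz 0)).fun_add ((hz 1).fun_mul (hz 1))).fun_add
    ((hz 2).fun_mul (hz 2))
  have h2 : ∀ t, γ t 0 * γ t 0 + γ t 1 * γ t 1 + γ t 2 * γ t 2 = 1 := fun t => by
    simpa [dotProduct, Fin.sum_univ_three] using hγ.mem_sphere t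
  rw [funext h2] at h1
  have := h1.unique (hasDerivAt_const t 1)
  simp only [dotProduct, Fin.sum_univ_three]
  linear_combination this / 2

theorem deriv_tangent (hγ : IsUnitGeodesic h γ) (t : ℝ) :
    deriv γ t ⬝ᵥ deriv γ t + γ t ⬝ᵥ deriv (deriv γ) t = 0 := by
  have hz := hasDerivAt_apply hγ.contDiff t
  have hz' := hasDerivAt_deriv_apply hγ.contDiff t
  have h1 := (((hz 0).fun_mul (hz' 0)).fun_add ((hz 1).fun_mul (hz' 1))).fun_add
    ((hz 2).fun_mul (hz' 2))
  have h2 : ∀ t, γ t 0 * deriv γ t 0 + γ t 1 * deriv γ t 1 + γ t 2 * deriv γ t 2 = 0 := fun t => by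
    simpa [dotProduct, Fin.sum_univ_three] using (hγ.isUnitTangent t).tangent
  rw [funext h2] at h1
  have := h1.unique (hasDerivAt_const t 0)
  simp only [dotProduct, Fin.sum_univ_three]
  linear_combination this

theorem angular_acceleration (P : IsZollProfile h k Ψ H) (hγ : IsUnitGeodesic h γ) (t : ℝ) :
    γ t 0 * deriv (deriv γ) t 1 - γ t 1 * deriv (deriv γ) t 0 = 0 := by
  by_cases ht : γ t 2 ^ 2 = 1
  · obtain ⟨h0, h1⟩ := eq_zero_of_sq_eq_one (hγ.mem_sphere t) ht
    simp [h0, h1]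
  · exact (P.height_of_euler_lagrange hγ.contDiff ht (hγ.mem_sphere t) (hγ.deriv_tangent t)
      (hγ.unit_speed t) (hγ.euler_lagrange t ht)).1

theorem angular_momentum (P : IsZollProfile h k Ψ H) (hγ : IsUnitGeodesic h γ) (t t₀ : ℝ) :
    γ t 0 * deriv γ t 1 - γ t 1 * deriv γ t 0 = γ t₀ 0 * deriv γ t₀ 1 - γ t₀ 1 * deriv γ t₀ 0 := by
  refine eq_of_hasDerivAt_eq (f' := fun _ => 0)
    (f := fun t => γ t 0 * deriv γ t 1 - γ t 1 * deriv γ t 0)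
    (g := fun _ => γ t₀ 0 * deriv γ t₀ 1 - γ t₀ 1 * deriv γ t₀ 0) (fun s => ?_)
    (fun s => hasDerivAt_const s _) t₀ rfl t
  have hz := hasDerivAt_apply hγ.contDiff s
  have hz' := hasDerivAt_deriv_apply hγ.contDiff s
  refine (((hz 0).fun_mul (hz' 1)).fun_sub ((hz 1).fun_mul (hz' 0))).congr_deriv ?_
  linear_combination hγ.angular_acceleration P s

theorem unit_pole (P : IsZollProfile h k Ψ H) (hγ : IsUnitGeodesic h γ) {t : ℝ}
    (ht : γ t 2 ^ 2 = 1) :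
    γ t 0 = 0 ∧ γ t 1 = 0 ∧ deriv γ t 2 = 0 ∧ h (γ t 2) = 0 ∧
      deriv γ t 0 * deriv γ t 0 + deriv γ t 1 * deriv γ t 1 = 1 := by
  have hT := hγ.isUnitTangent t
  obtain ⟨h0, h1⟩ := eq_zero_of_sq_eq_one (hγ.mem_sphere t) ht
  have h2 := tangent_pole hT.mem_sphere hT.tangent ht
  refine ⟨h0, h1, h2, by rw [P.eq, ht]; ring, ?_⟩
  have := hγ.unit_speed t
  rw [P.zollMetric_tangent hT.mem_sphere hT.tangent, h2] at this
  linear_combination this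

theorem height_equation (P : IsZollProfile h k Ψ H) (hγ : IsUnitGeodesic h γ) (t : ℝ) :
    (1 + h (γ t 2)) ^ 2 * deriv (deriv γ) t 2 +
      (1 + h (γ t 2)) * deriv h (γ t 2) * deriv γ t 2 ^ 2 + γ t 2 = 0 := by
  by_cases ht : γ t 2 ^ 2 = 1
  · obtain ⟨h0, h1, h2, h3, h4⟩ := hγ.unit_pole P ht
    have h5 := hγ.deriv_tangent t
    simp only [dotProduct, Fin.sum_univ_three, h0, h1, h2] at h5
    rw [h3, h2]
    linear_combination γ t 2 * (h5 - h4) - deriv (deriv γ) t 2 * ht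
  · exact (P.height_of_euler_lagrange hγ.contDiff ht (hγ.mem_sphere t) (hγ.deriv_tangent t)
      (hγ.unit_speed t) (hγ.euler_lagrange t ht)).2

/-- The horizontal acceleration is parallel to the velocity, by dividing the angular identity by `s
- t` and letting `s → t`, and orthogonal to it, by differentiating the unit speed condition. -/
theorem acceleration_pole (P : IsZollProfile h k Ψ H) (hγ : IsUnitGeodesic h γ) {t : ℝ}
    (ht : γ t 2 ^ 2 = 1) : deriv (deriv γ) t 0 = 0 ∧ deriv (deriv γ) t 1 = 0 := by
  obtain ⟨h0, h1, h2, h3, h4⟩ := hγ.unit_pole P ht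
  have hz := hasDerivAt_apply hγ.contDiff
  have hz' := hasDerivAt_deriv_apply hγ.contDiff
  have hcont : ∀ i, Continuous fun s => deriv (deriv γ) s i := fun i => by
    have h1 : ContDiff ℝ 1 (deriv γ) := ((contDiff_succ_iff_deriv (n := 1)).1 hγ.contDiff).2.2
    exact (continuous_apply i).comp (h1.continuous_deriv le_rfl)
  have e1 : deriv γ t 0 * deriv (deriv γ) t 1 - deriv γ t 1 * deriv (deriv γ) t 0 = 0 := by
    have hlim := ((hz t 0).tendsto_slope.mul ((hcont 1).tendsto t |>.mono_left nhdsWithin_le_nhds)).sub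
      ((hz t 1).tendsto_slope.mul ((hcont 0).tendsto t |>.mono_left nhdsWithin_le_nhds))
    refine tendsto_nhds_unique hlim (tendsto_const_nhds.congr fun s => ?_)
    simp only [slope_def_field, h0, h1, sub_zero]
    linear_combination -(s - t)⁻¹ * hγ.angular_acceleration P s
  have e2 : deriv γ t 0 * deriv (deriv γ) t 0 + deriv γ t 1 * deriv (deriv γ) t 1 = 0 := by
    have hu : ∀ s, deriv γ s 0 * deriv γ s 0 + deriv γ s 1 * deriv γ s 1 +
        (1 + k (γ s 2) * (2 + h (γ s 2))) * (deriv γ s 2 * deriv γ s 2) = 1 := fun s => by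
      have := hγ.unit_speed s
      rw [P.zollMetric_tangent (hγ.mem_sphere s) (hγ.isUnitTangent s).tangent] at this
      linear_combination this
    have hq := (((P.hasDerivAt_quotient (γ t 2)).comp t (hz t 2)).fun_mul
      (((P.hasDerivAt (γ t 2)).comp t (hz t 2)).const_add 2)).const_add 1
    have hd := (((hz' t 0).fun_mul (hz' t 0)).fun_add ((hz' t 1).fun_mul (hz' t 1))).fun_add
      (hq.fun_mul ((hz' t 2).fun_mul (hz' t 2)))
    simp only [Function.comp_apply] at hd
    rw [funext hu] at hd
    have := hd.unique (hasDerivAt_const t 1)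
    rw [h2] at this
    linear_combination this / 2
  constructor
  · linear_combination deriv γ t 0 * e2 - deriv γ t 1 * e1 - deriv (deriv γ) t 0 * h4
  · linear_combination deriv γ t 1 * e2 + deriv γ t 0 * e1 - deriv (deriv γ) t 1 * h4

/-- These equations say that the planar vector of `HasPhase` turns at the rate of `Ψ`. They come
from `horizontal_equation_aux` off the poles and from the vanishing horizontal acceleration at them.
-/
theorem horizontal_equation (P : IsZollProfile h k Ψ H) (hγ : IsUnitGeodesic h γ) {c t : ℝ}
    (hc : γ t 0 * deriv γ t 1 - γ t 1 * deriv γ t 0 = c) :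
    (1 + h (γ t 2)) ^ 2 * deriv (deriv γ) t 0 + (1 + h (γ t 2)) *
      (deriv h (γ t 2) * deriv γ t 2 * deriv γ t 0 + c * deriv k (γ t 2) * deriv γ t 2 * γ t 1 +
        2 * c * k (γ t 2) * deriv γ t 1) + γ t 0 * (1 - c ^ 2 * k (γ t 2) ^ 2) = 0 ∧
    (1 + h (γ t 2)) ^ 2 * deriv (deriv γ) t 1 + (1 + h (γ t 2)) *
      (deriv h (γ t 2) * deriv γ t 2 * deriv γ t 1 - c * deriv k (γ t 2) * deriv γ t 2 * γ t 0 -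
        2 * c * k (γ t 2) * deriv γ t 0) + γ t 1 * (1 - c ^ 2 * k (γ t 2) ^ 2) = 0 := by
  by_cases ht : γ t 2 ^ 2 = 1
  · obtain ⟨h0, h1, h2, h3, h4⟩ := hγ.unit_pole P ht
    obtain ⟨h5, h6⟩ := hγ.acceleration_pole P ht
    have : c = 0 := by rw [← hc, h0, h1]; ring
    simp [h0, h1, h2, h5, h6, this]
  · have hN : 1 - γ t 2 ^ 2 ≠ 0 := fun h' => ht (by linarith)
    have hT := hγ.isUnitTangent t
    have hs := hγ.mem_sphere t
    have htan := hT.tangent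
    have hs2 := hγ.deriv_tangent t
    have hu := hγ.unit_speed t
    have hcl := P.clairaut hT
    have hc2 := hγ.angular_acceleration P t
    have hz2 := hγ.height_equation P t
    rw [P.zollMetric_tangent hs htan] at hu
    rw [hc] at hcl
    simp only [dotProduct, Fin.sum_univ_three] at hs htan hs2
    refine ⟨(mul_eq_zero.1 (horizontal_equation_aux hs htan hs2 hu hc hc2 hz2 hcl (P.eq _)
      (P.hasDerivAt _).deriv)).resolve_left hN, ?_⟩
    -- The second equation is the first after the quarter turn `(x, y) ↦ (y, -x)`.
    have := (mul_eq_zero.1 (horizontal_equation_aux (x := γ t 1) (y := -γ t 0) (x1 := deriv γ t 1)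
      (y1 := -deriv γ t 0) (x2 := deriv (deriv γ) t 1) (y2 := -deriv (deriv γ) t 0)
      (by linear_combination hs) (by linear_combination htan) (by linear_combination hs2)
      (by linear_combination hu) (by linear_combination hc) (by linear_combination hc2) hz2 hcl
      (P.eq _) (P.hasDerivAt _).deriv)).resolve_left hN
    linear_combination this

/-- A unit speed geodesic with coordinates `(R, Θ)` has a phase at each of its points. -/
theorem exists_hasPhase (P : IsZollProfile h k Ψ H) (hγ : IsUnitGeodesic h γ) {R Θ : ℝ}
    (hc : HasGeodesicCoords γ R Θ) (t : ℝ) :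
    ∃ φ, HasPhase h k Ψ (γ t) (deriv γ t) R Θ φ := by
  obtain ⟨-, -, t₀, hp, hv⟩ := hc
  have hang : ∀ t, γ t 0 * deriv γ t 1 - γ t 1 * deriv γ t 0 = sin R := fun t => by
    rw [hγ.angular_momentum P t t₀, hp, hv]
    simp [spherePoint]
    linear_combination sin R * sin_sq_add_cos_sq Θ
  have hz := hasDerivAt_apply hγ.contDiff
  have hz' := hasDerivAt_deriv_apply hγ.contDiff
  have hpos : ∀ t, 1 + h (γ t 2) ≠ 0 := fun t =>
    (P.pos _ (sq_le_one_of_sphere (hγ.mem_sphere t))).ne'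
  have hcont : Continuous fun t => (1 + h (γ t 2))⁻¹ := by
    have h1 : Continuous fun t => γ t 2 := (continuous_apply 2).comp hγ.contDiff.continuous
    have h2 := P.contDiff_self.continuous
    exact Continuous.inv₀ (by fun_prop) hpos
  -- `A` is the phase, obtained by integrating `dφ/dt = (1 + h z)⁻¹` from the point nearest the
  -- pole.
  obtain ⟨A, hA₀, hA⟩ : ∃ A : ℝ → ℝ, A t₀ = 0 ∧ ∀ t, HasDerivAt A (1 + h (γ t 2))⁻¹ t :=
    ⟨fun t => ∫ s in t₀..t, (1 + h (γ s 2))⁻¹, by simp, fun t =>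
      intervalIntegral.integral_hasDerivAt_right (hcont.intervalIntegrable _ _)
        hcont.aestronglyMeasurable.stronglyMeasurableAtFilter hcont.continuousAt⟩
  have hh : ∀ t, HasDerivAt (fun t => h (γ t 2)) (deriv h (γ t 2) * deriv γ t 2) t := fun t =>
    ((P.hasDerivAt (γ t 2)).differentiableAt.hasDerivAt).comp t (hz t 2)
  have hk : ∀ t, HasDerivAt (fun t => k (γ t 2)) (deriv k (γ t 2) * deriv γ t 2) t := fun t =>
    (P.hasDerivAt_quotient (γ t 2)).comp t (hz t 2)
  have hheight := eq_cos_sin_of_rotation (f := fun t => γ t 2)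
    (g := fun t => -((1 + h (γ t 2)) * deriv γ t 2)) (β := A) (r := cos R) (t₀ := t₀)
    (fun t => (hz t 2).congr_deriv (by have := hpos t; field_simp))
    (fun t => ((((hh t).const_add 1).fun_mul (hz' t 2)).fun_neg).congr_deriv (by
      have := hpos t
      field_simp
      linear_combination -hγ.height_equation P t))
    hA (by simp [hA₀, hp, spherePoint]) (by simp [hA₀, hv])
  have hzA : ∀ t, γ t 2 = cos R * cos (A t) := fun t => (hheight t).1
  have hrot : ∀ t, HasDerivAt (fun t => Θ + Ψ R (sin (A t)))
      ((1 + h (γ t 2))⁻¹ * (sin R * k (γ t 2))) t := fun t => by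
    refine (((P.rotation R (A t)).comp t (hA t)).const_add Θ).congr_deriv ?_
    rw [hzA]
    ring
  have hfinal := eq_cos_sin_of_rotation
    (f := fun t => sin (A t) * γ t 1 +
      cos (A t) * ((1 + h (γ t 2)) * deriv γ t 1 - sin R * k (γ t 2) * γ t 0))
    (g := fun t => -(sin (A t) * γ t 0 +
      cos (A t) * ((1 + h (γ t 2)) * deriv γ t 0 + sin R * k (γ t 2) * γ t 1)))
    (β := fun t => Θ + Ψ R (sin (A t))) (r := 1) (t₀ := t₀)
    (fun t => (((hA t).sin.fun_mul (hz t 1)).fun_add ((hA t).cos.fun_mul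
      ((((hh t).const_add 1).fun_mul (hz' t 1)).fun_sub
        (((hk t).const_mul (sin R)).fun_mul (hz t 0))))).congr_deriv (by
      have := hpos t
      have hE := (hγ.horizontal_equation P (hang t)).2
      field_simp
      linear_combination cos (A t) * hE))
    (fun t => (((hA t).sin.fun_mul (hz t 0)).fun_add ((hA t).cos.fun_mul
      ((((hh t).const_add 1).fun_mul (hz' t 0)).fun_add
        (((hk t).const_mul (sin R)).fun_mul (hz t 1))))).fun_neg.congr_deriv (by
      have := hpos t
      have hE := (hγ.horizontal_equation P (hang t)).1
      field_simp
      linear_combination -cos (A t) * hE))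
    hrot ?_ ?_ t
  · refine ⟨A t, hang t, hzA t, ?_, ?_, ?_⟩
    · linear_combination -(hheight t).2
    · linear_combination -hfinal.2
    · linear_combination hfinal.1
  all_goals
    have he := P.eq (cos R)
    have h1 := sin_sq_add_cos_sq R
    simp [hA₀, hp, hv, spherePoint, P.rotation_zero]
  · linear_combination cos Θ * (he - k (cos R) * h1)
  · linear_combination sin Θ * (he - k (cos R) * h1)

end IsUnitGeodesic

/-- After this, no geodesic has to be followed in time: the projection is a set of equations in `p`,
`u`, `R`, `Θ` and `φ`. -/
theorem IsZollProfile.projectsTo_iff {h k : ℝ → ℝ} {Ψ H : ℝ → ℝ → ℝ} (P : IsZollProfile h k Ψ H)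
    {p u : Fin 3 → ℝ} {R Θ : ℝ} :
    ProjectsTo h p u R Θ ↔ -(π / 2) < R ∧ R < π / 2 ∧ IsUnitTangent h p u ∧
      ∃ φ, HasPhase h k Ψ p u R Θ φ := by
  constructor
  · rintro ⟨γ, hγ, rfl, rfl, hc⟩
    exact ⟨hc.1, hc.2.1, hγ.isUnitTangent 0, hγ.exists_hasPhase P hc 0⟩
  · rintro ⟨h1, h2, hu, φ, hφ⟩
    obtain ⟨rfl, rfl⟩ := P.eq_phase hu hφ
    exact P.projectsTo_phase Θ φ h1 h2

/-! ### Turning a unit vector in its tangent plane -/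

theorem IsUnitTangent.turn {h : ℝ → ℝ} {p u m : Fin 3 → ℝ} (hu : IsUnitTangent h p u)
    (hm : IsUnitNormal h p u m) (s : ℝ) : IsUnitTangent h p (cos s • u - sin s • m) := by
  obtain ⟨h1, h2, h3⟩ := hu
  obtain ⟨h4, h5, h6, -⟩ := hm
  refine ⟨h1, by simp [h2, h4], ?_⟩
  have h7 := sin_sq_add_cos_sq s
  simp only [zollMetric, dotProduct, Fin.sum_univ_three, Pi.sub_apply, Pi.smul_apply,
    smul_eq_mul] at *
  generalize h (p 2) * (2 + h (p 2)) / (1 - p 2 ^ 2) = q at *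
  linear_combination cos s ^ 2 * h3 + sin s ^ 2 * h5 - 2 * sin s * cos s * h6 + h7

theorem eq_zero_of_cross_eq_zero {u d : Fin 3 → ℝ} {q : ℝ} (h0 : u 1 * d 2 - u 2 * d 1 = 0)
    (h1 : u 2 * d 0 - u 0 * d 2 = 0) (h2 : u 0 * d 1 - u 1 * d 0 = 0)
    (hd : u 0 * d 0 + u 1 * d 1 + u 2 * d 2 + q * (u 2 * d 2) = 0)
    (hu : u 0 * u 0 + u 1 * u 1 + u 2 * u 2 + q * (u 2 * u 2) = 1) : d = 0 := by
  have h3 : u 0 * d 0 + u 1 * d 1 + u 2 * d 2 = 0 := by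
    linear_combination (u 0 * u 0 + u 1 * u 1 + u 2 * u 2) * hd -
      (u 0 * d 0 + u 1 * d 1 + u 2 * d 2) * hu + q * u 2 * (u 0 * h1 - u 1 * h0)
  have hN : u 0 * u 0 + u 1 * u 1 + u 2 * u 2 ≠ 0 := fun h' => by
    have : u 2 * u 2 = 0 := by
      nlinarith [mul_self_nonneg (u 0), mul_self_nonneg (u 1), mul_self_nonneg (u 2)]
    rw [h', this] at hu
    simp at hu
  ext i
  refine (mul_eq_zero.1 ?_).resolve_left hN
  fin_cases i <;> simp only [Fin.zero_eta, Fin.mk_one, Fin.reduceFinMk]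
  · linear_combination u 0 * h3 + u 2 * h1 - u 1 * h2
  · linear_combination u 1 * h3 + u 0 * h2 - u 2 * h0
  · linear_combination u 2 * h3 + u 1 * h0 - u 0 * h1

theorem cross_eq_of_tangent {p u m : Fin 3 → ℝ} {l : ℝ} (hs : p ⬝ᵥ p = 1) (hu : p ⬝ᵥ u = 0)
    (hm : p ⬝ᵥ m = 0) (hl : l = p ⬝ᵥ (u ⨯₃ m)) :
    u 1 * m 2 - u 2 * m 1 = l * p 0 ∧ u 2 * m 0 - u 0 * m 2 = l * p 1 ∧
      u 0 * m 1 - u 1 * m 0 = l * p 2 := by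
  simp only [cross_apply, dotProduct, Fin.sum_univ_three, Matrix.cons_val] at *
  subst hl
  refine ⟨?_, ?_, ?_⟩
  · linear_combination -(u 1 * m 2 - u 2 * m 1) * hs - p 1 * (u 2 * hm - m 2 * hu) +
      p 2 * (u 1 * hm - m 1 * hu)
  · linear_combination -(u 2 * m 0 - u 0 * m 2) * hs - p 2 * (u 0 * hm - m 0 * hu) +
      p 0 * (u 2 * hm - m 2 * hu)
  · linear_combination -(u 0 * m 1 - u 1 * m 0) * hs - p 0 * (u 1 * hm - m 1 * hu) +
      p 1 * (u 0 * hm - m 0 * hu)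

/-- Both `u ⨯₃ m` and `u ⨯₃ m'` are multiples of `p`, so a combination of `m` and `m'` is parallel
to `u`; being also orthogonal to `u`, it is zero. Length and sign do the rest. -/
theorem IsUnitNormal.unique {h : ℝ → ℝ} {p u m m' : Fin 3 → ℝ} (hu : IsUnitTangent h p u)
    (hm : IsUnitNormal h p u m) (hm' : IsUnitNormal h p u m') : m = m' := by
  obtain ⟨h1, h2, h3⟩ := hu
  obtain ⟨a1, a2, a3, a4⟩ := hm
  obtain ⟨b1, b2, b3, b4⟩ := hm'
  obtain ⟨c0, c1, c2⟩ := cross_eq_of_tangent h1 h2 a1 rfl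
  obtain ⟨d0, d1, d2⟩ := cross_eq_of_tangent h1 h2 b1 rfl
  generalize p ⬝ᵥ (u ⨯₃ m) = l at *
  generalize p ⬝ᵥ (u ⨯₃ m') = l' at *
  simp only [zollMetric, dotProduct, Fin.sum_univ_three] at *
  generalize h (p 2) * (2 + h (p 2)) / (1 - p 2 ^ 2) = q at *
  have hd : l' • m - l • m' = 0 := by
    refine eq_zero_of_cross_eq_zero (u := u) (q := q) ?_ ?_ ?_ ?_ h3 <;>
      simp only [Pi.sub_apply, Pi.smul_apply, smul_eq_mul]
    · linear_combination l' * c0 - l * d0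
    · linear_combination l' * c1 - l * d1
    · linear_combination l' * c2 - l * d2
    · linear_combination l' * a3 - l * b3
  have he : ∀ i, l' * m i = l * m' i := fun i => by
    simpa [sub_eq_zero] using congrFun hd i
  have hll : l' ^ 2 = l ^ 2 := by
    linear_combination l ^ 2 * b2 - l' ^ 2 * a2 + (l' * m 0 + l * m' 0) * he 0 +
      (l' * m 1 + l * m' 1) * he 1 + (1 + q) * (l' * m 2 + l * m' 2) * he 2
  have : l' = l := (sq_eq_sq₀ b4.le a4.le).1 hll
  subst this
  ext i
  exact mul_left_cancel₀ b4.ne' (he i)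

/-- The sine of the phase of `cos s • u - sin s • m`, on a geodesic of nearest colatitude `ρ s`. -/
noncomputable def turnedSin (h : ℝ → ℝ) (p u m : Fin 3 → ℝ) (ρ : ℝ → ℝ) (s : ℝ) : ℝ :=
  -((1 + h (p 2)) * (cos s * u 2 - sin s * m 2)) / cos (ρ s)

/-- Minus the sine of the rotation angle of `cos s • u - sin s • m`. -/
noncomputable def turnedFst (h k : ℝ → ℝ) (p u m : Fin 3 → ℝ) (ρ : ℝ → ℝ) (s : ℝ) : ℝ :=
  turnedSin h p u m ρ s * p 0 + p 2 / cos (ρ s) *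
    ((1 + h (p 2)) * (cos s * u 0 - sin s * m 0) + sin (ρ s) * k (p 2) * p 1)

/-- The cosine of the rotation angle of `cos s • u - sin s • m`. -/
noncomputable def turnedSnd (h k : ℝ → ℝ) (p u m : Fin 3 → ℝ) (ρ : ℝ → ℝ) (s : ℝ) : ℝ :=
  turnedSin h p u m ρ s * p 1 + p 2 / cos (ρ s) *
    ((1 + h (p 2)) * (cos s * u 1 - sin s * m 1) - sin (ρ s) * k (p 2) * p 0)

theorem hasPhase_turn_iff {h k : ℝ → ℝ} {Ψ : ℝ → ℝ → ℝ} {p u m : Fin 3 → ℝ} {ρ : ℝ → ℝ} {s Θ φ : ℝ}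
    (hρ : cos (ρ s) ≠ 0) :
    HasPhase h k Ψ p (cos s • u - sin s • m) (ρ s) Θ φ ↔
      sin (ρ s) = p 0 * (cos s * u 1 - sin s * m 1) - p 1 * (cos s * u 0 - sin s * m 0) ∧
      cos φ = p 2 / cos (ρ s) ∧ sin φ = turnedSin h p u m ρ s ∧
      -sin (Θ + Ψ (ρ s) (turnedSin h p u m ρ s)) = turnedFst h k p u m ρ s ∧
      cos (Θ + Ψ (ρ s) (turnedSin h p u m ρ s)) = turnedSnd h k p u m ρ s := by
  have e1 : p 2 = cos (ρ s) * cos φ ↔ cos φ = p 2 / cos (ρ s) := by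
    rw [eq_div_iff hρ, mul_comm, eq_comm]
  have e2 : (1 + h (p 2)) * (cos s * u 2 - sin s * m 2) = -(cos (ρ s) * sin φ) ↔
      sin φ = turnedSin h p u m ρ s := by
    rw [turnedSin, eq_div_iff hρ]
    constructor <;> intro h' <;> linear_combination h'
  constructor
  · rintro ⟨h1, h2, h3, h4, h5⟩
    simp only [Pi.sub_apply, Pi.smul_apply, smul_eq_mul] at *
    rw [e1] at h2
    rw [e2] at h3
    rw [h2, h3] at h4 h5
    exact ⟨h1.symm, h2, h3, h4.symm, h5.symm⟩
  · rintro ⟨h1, h2, h3, h4, h5⟩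
    refine ⟨h1.symm, e1.2 h2, e2.2 h3, ?_, ?_⟩ <;>
      simp only [Pi.sub_apply, Pi.smul_apply, smul_eq_mul, h2, h3]
    · exact h4.symm
    · exact h5.symm

namespace IsZollProfile

variable {h k : ℝ → ℝ} {Ψ H : ℝ → ℝ → ℝ}

theorem turned_zero {p u m : Fin 3 → ℝ} {R Θ φ : ℝ} {ρ : ℝ → ℝ} (hφ : HasPhase h k Ψ p u R Θ φ)
    (hR : cos R ≠ 0) (hρ : ρ 0 = R) :
    turnedSin h p u m ρ 0 = sin φ ∧ turnedFst h k p u m ρ 0 = -sin (Θ + Ψ R (sin φ)) ∧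
      turnedSnd h k p u m ρ 0 = cos (Θ + Ψ R (sin φ)) := by
  have h1 := (hasPhase_turn_iff (h := h) (k := k) (Ψ := Ψ) (p := p) (u := u) (m := m) (ρ := ρ)
    (s := 0) (Θ := Θ) (φ := φ) (by rwa [hρ])).1 (by simpa [hρ] using hφ)
  obtain ⟨-, -, h3, h4, h5⟩ := h1
  rw [hρ, ← h3] at h4 h5
  exact ⟨h3.symm, h4.symm, h5.symm⟩

theorem hasDerivAt_turn (a b : ℝ) : HasDerivAt (fun s => cos s * a - sin s * b) (-b) 0 := by
  simpa using ((hasDerivAt_cos 0).mul_const a).fun_sub ((hasDerivAt_sin 0).mul_const b)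

/-- This is the derivative of `sin (ρ s)`, hence `ρ' = -sin φ`. -/
theorem hasDerivAt_angular (P : IsZollProfile h k Ψ H) (β R φ : ℝ) :
    HasDerivAt (fun s => phasePoint β R φ 0 *
        (cos s * phaseVelocity h k β R φ 1 - sin s * phaseNormal h k β R φ 1) -
      phasePoint β R φ 1 *
        (cos s * phaseVelocity h k β R φ 0 - sin s * phaseNormal h k β R φ 0))
      (-(cos R * sin φ)) 0 := by
  refine (((hasDerivAt_turn _ _).const_mul _).fun_sub
    ((hasDerivAt_turn _ _).const_mul _)).congr_deriv ?_
  have hn := (P.phase_pos R φ).ne'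
  have h3 := sin_sq_add_cos_sq β
  simp [phasePoint, phaseNormal]
  generalize h (cos R * cos φ) = h0, k (cos R * cos φ) = k0 at *
  field_simp
  linear_combination -cos R * sin φ * h3 * (1 + h0)

theorem hasDerivAt_turnedSin (P : IsZollProfile h k Ψ H) {β R φ : ℝ} {ρ : ℝ → ℝ} (hR : cos R ≠ 0)
    (hρ : ρ 0 = R) (hρ' : HasDerivAt ρ (-sin φ) 0) :
    HasDerivAt (turnedSin h (phasePoint β R φ) (phaseVelocity h k β R φ) (phaseNormal h k β R φ) ρ)
      (sin R / cos R * (1 - sin φ ^ 2)) 0 := by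
  subst hρ
  refine ((((hasDerivAt_turn _ _).const_mul _).fun_neg).fun_div hρ'.cos hR).congr_deriv ?_
  have hn := (P.phase_pos (ρ 0) φ).ne'
  simp [phasePoint, phaseVelocity, phaseNormal]
  generalize h (cos (ρ 0) * cos φ) = h0 at *
  field_simp

/-- Together with `hasDerivAt_turnedSnd` this says that the total angle `β` has derivative `-cos φ /
cos R`: all terms in `h` and `k` cancel. -/
theorem hasDerivAt_turnedFst (P : IsZollProfile h k Ψ H) {β R φ : ℝ} {ρ : ℝ → ℝ} (hR : cos R ≠ 0)
    (hρ : ρ 0 = R) (hρ' : HasDerivAt ρ (-sin φ) 0) :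
    HasDerivAt
      (turnedFst h k (phasePoint β R φ) (phaseVelocity h k β R φ) (phaseNormal h k β R φ) ρ)
      (cos β * (cos φ / cos R)) 0 := by
  have hσ := P.hasDerivAt_turnedSin (β := β) hR hρ hρ'
  subst hρ
  have hκ := (hasDerivAt_const (0 : ℝ) (phasePoint β (ρ 0) φ 2)).fun_div hρ'.cos hR
  refine ((hσ.mul_const _).fun_add (hκ.fun_mul (((hasDerivAt_turn _ _).const_mul _).fun_add
    ((hρ'.sin.mul_const _).mul_const _)))).congr_deriv ?_
  have hn := (P.phase_pos (ρ 0) φ).ne'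
  have h1 := sin_sq_add_cos_sq (ρ 0)
  have h2 := sin_sq_add_cos_sq φ
  have he := P.eq (cos (ρ 0) * cos φ)
  simp [phasePoint, phaseVelocity, phaseNormal]
  generalize h (cos (ρ 0) * cos φ) = h0, k (cos (ρ 0) * cos φ) = k0 at *
  field_simp
  linear_combination cos β * cos φ * (h1 + cos (ρ 0) ^ 2 * (he - k0 * (cos φ ^ 2 * h1 + h2))) +
    sin β * sin (ρ 0) * sin φ * h2

theorem hasDerivAt_turnedSnd (P : IsZollProfile h k Ψ H) {β R φ : ℝ} {ρ : ℝ → ℝ} (hR : cos R ≠ 0)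
    (hρ : ρ 0 = R) (hρ' : HasDerivAt ρ (-sin φ) 0) :
    HasDerivAt
      (turnedSnd h k (phasePoint β R φ) (phaseVelocity h k β R φ) (phaseNormal h k β R φ) ρ)
      (sin β * (cos φ / cos R)) 0 := by
  have hσ := P.hasDerivAt_turnedSin (β := β) hR hρ hρ'
  subst hρ
  have hκ := (hasDerivAt_const (0 : ℝ) (phasePoint β (ρ 0) φ 2)).fun_div hρ'.cos hR
  refine ((hσ.mul_const _).fun_add (hκ.fun_mul (((hasDerivAt_turn _ _).const_mul _).fun_sub
    ((hρ'.sin.mul_const _).mul_const _)))).congr_deriv ?_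
  have hn := (P.phase_pos (ρ 0) φ).ne'
  have h1 := sin_sq_add_cos_sq (ρ 0)
  have h2 := sin_sq_add_cos_sq φ
  have he := P.eq (cos (ρ 0) * cos φ)
  simp [phasePoint, phaseVelocity, phaseNormal]
  generalize h (cos (ρ 0) * cos φ) = h0, k (cos (ρ 0) * cos φ) = k0 at *
  field_simp
  linear_combination sin β * cos φ * (h1 + cos (ρ 0) ^ 2 * (he - k0 * (cos φ ^ 2 * h1 + h2))) -
    cos β * sin (ρ 0) * sin φ * h2

end IsZollProfile

/-! ### The velocity of the projected curve -/

theorem exists_cos_sin_eq {x y : ℝ} (hxy : x ^ 2 + y ^ 2 = 1) : ∃ φ, cos φ = x ∧ sin φ = y := by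
  have hx : -1 ≤ x ∧ x ≤ 1 := abs_le.1 (abs_le_one_iff_mul_self_le_one.2 (by nlinarith))
  have h1 : √(1 - x ^ 2) = |y| := by rw [← sqrt_sq_eq_abs]; congr 1; linarith
  rcases le_total 0 y with hy | hy
  · exact ⟨arccos x, cos_arccos hx.1 hx.2, by rw [sin_arccos, h1, abs_of_nonneg hy]⟩
  · exact ⟨-arccos x, by rw [cos_neg, cos_arccos hx.1 hx.2],
      by rw [sin_neg, sin_arccos, h1, abs_of_nonpos hy, neg_neg]⟩

/-- Turning the circle so that the value at `t` has angle `0`, the angle is an arcsine nearby. Only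
differentiability at the single point `t` is needed. -/
theorem exists_angle {X Y : ℝ → ℝ} {X' Y' t β₀ : ℝ} (hX : HasDerivAt X X' t)
    (hY : HasDerivAt Y Y' t) (hX₀ : X t = -sin β₀) (hY₀ : Y t = cos β₀)
    (hXY : ∀ᶠ s in 𝓝 t, X s ^ 2 + Y s ^ 2 = 1) :
    ∃ (β : ℝ → ℝ) (β' : ℝ), β t = β₀ ∧ HasDerivAt β β' t ∧
      ∀ᶠ s in 𝓝 t, -sin (β s) = X s ∧ cos (β s) = Y s := by
  set τ : ℝ → ℝ := fun s => -(X s * cos β₀) - Y s * sin β₀ with hτ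
  set χ : ℝ → ℝ := fun s => Y s * cos β₀ - X s * sin β₀ with hχ
  have hτ0 : τ t = 0 := by simp only [hτ, hX₀, hY₀]; ring
  have hχ0 : χ t = 1 := by
    simp only [hχ, hX₀, hY₀]
    linear_combination sin_sq_add_cos_sq β₀
  have hτ' : HasDerivAt τ _ t := (hX.mul_const (cos β₀)).fun_neg.fun_sub (hY.mul_const (sin β₀))
  have hχ' : HasDerivAt χ _ t := (hY.mul_const (cos β₀)).fun_sub (hX.mul_const (sin β₀))
  refine ⟨fun s => β₀ + arcsin (τ s), _, by simp [hτ0],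
    ((hasDerivAt_arcsin (x := τ t) (by simp [hτ0]) (by simp [hτ0])).comp t hτ').const_add β₀, ?_⟩
  have ev : ∀ᶠ s in 𝓝 t, 0 < χ s :=
    hχ'.continuousAt.tendsto.eventually_const_lt (by rw [hχ0]; exact one_pos)
  filter_upwards [ev, hXY] with s hs hXYs
  have hτχ : τ s ^ 2 + χ s ^ 2 = 1 := by
    simp only [hτ, hχ]
    linear_combination hXYs + (X s ^ 2 + Y s ^ 2) * sin_sq_add_cos_sq β₀
  have hsτ : sin (arcsin (τ s)) = τ s :=
    sin_arcsin (by nlinarith [sq_nonneg (χ s)]) (by nlinarith [sq_nonneg (χ s)])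
  have hcτ : cos (arcsin (τ s)) = χ s := by
    rw [cos_arcsin, ← sqrt_sq hs.le]
    congr 1
    linarith
  constructor
  · rw [sin_add, hsτ, hcτ]
    simp only [hτ, hχ]
    linear_combination X s * sin_sq_add_cos_sq β₀
  · rw [cos_add, hsτ, hcτ]
    simp only [hτ, hχ]
    linear_combination Y s * sin_sq_add_cos_sq β₀

namespace IsZollProfile

variable {h k : ℝ → ℝ} {Ψ H : ℝ → ℝ → ℝ}

/-- Near `0`, the angle `ϑ + Ψ` has prescribed sine and cosine; differentiating both gives `v₂ + D =
-cos φ / cos R`. -/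
theorem canonicalImage_eq (P : IsZollProfile h k Ψ H) {R Θ φ D : ℝ} {v : ℝ × ℝ}
    (hD : ∀ ρ σ : ℝ → ℝ, ρ 0 = R → σ 0 = sin φ → HasDerivAt ρ (-sin φ) 0 →
      HasDerivAt σ (sin R / cos R * (1 - sin φ ^ 2)) 0 → HasDerivAt (fun s => Ψ (ρ s) (σ s)) D 0)
    (hR : cos R ≠ 0)
    (hv : IsCanonicalImage h (phasePoint (Θ + Ψ R (sin φ)) R φ)
      (phaseVelocity h k (Θ + Ψ R (sin φ)) R φ) R Θ v) :
    v.1 = -sin φ ∧ v.2 = -(cos φ / cos R) - D := by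
  obtain ⟨m, hm, ρ, ϑ, hρ, hϑ, hρ', hϑ', hs⟩ := hv
  have hφ := P.hasPhase_phase R Θ φ
  have hu := P.isUnitTangent_phase (Θ + Ψ R (sin φ)) R φ
  obtain rfl := hm.unique hu (P.isUnitNormal_phase _ R φ)
  have hcos : ∀ᶠ s in 𝓝 (0 : ℝ), cos (ρ s) ≠ 0 :=
    hρ'.cos.continuousAt.eventually_ne (by rwa [hρ])
  have hs' := (hs.and hcos).mono fun s hs => by
    obtain ⟨-, -, -, φs, hφs⟩ := P.projectsTo_iff.1 hs.1
    have := (hasPhase_turn_iff hs.2).1 hφs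
    exact And.intro this.1 this.2.2.2
  have h1 : v.1 = -sin φ := by
    have e1 := hρ'.sin.unique ((P.hasDerivAt_angular (Θ + Ψ R (sin φ)) R φ).congr_of_eventuallyEq
      (hs'.mono fun s hs => hs.1))
    rw [hρ] at e1
    exact mul_left_cancel₀ hR (by linear_combination e1)
  refine ⟨h1, ?_⟩
  rw [h1] at hρ'
  obtain ⟨z1, z2, z3⟩ := turned_zero (m := phaseNormal h k (Θ + Ψ R (sin φ)) R φ) hφ hR hρ
  have hβ := hϑ'.fun_add (hD ρ _ hρ z1 hρ' (P.hasDerivAt_turnedSin (β := Θ + Ψ R (sin φ)) hR hρ hρ'))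
  have e2 := hβ.sin.fun_neg.unique ((P.hasDerivAt_turnedFst (β := Θ + Ψ R (sin φ)) hR hρ
    hρ').congr_of_eventuallyEq (hs'.mono fun s hs => hs.2.1))
  have e3 := hβ.cos.unique ((P.hasDerivAt_turnedSnd (β := Θ + Ψ R (sin φ)) hR hρ
    hρ').congr_of_eventuallyEq (hs'.mono fun s hs => hs.2.2))
  rw [hρ, hϑ, z1] at e2 e3
  linear_combination -cos (Θ + Ψ R (sin φ)) * e2 - sin (Θ + Ψ R (sin φ)) * e3 -
    (v.2 + D + cos φ / cos R) * sin_sq_add_cos_sq (Θ + Ψ R (sin φ))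

theorem rotation_sq_add_sq (P : IsZollProfile h k Ψ H) {p u : Fin 3 → ℝ} {R φ : ℝ}
    (hu : IsUnitTangent h p u) (hang : p 0 * u 1 - p 1 * u 0 = sin R)
    (hheight : p 2 = cos R * cos φ) (hspeed : (1 + h (p 2)) * u 2 = -(cos R * sin φ)) :
    (sin φ * p 0 + cos φ * ((1 + h (p 2)) * u 0 + sin R * k (p 2) * p 1)) ^ 2 +
      (sin φ * p 1 + cos φ * ((1 + h (p 2)) * u 1 - sin R * k (p 2) * p 0)) ^ 2 = 1 := by
  have hs := hu.mem_sphere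
  have ht := hu.tangent
  have hn := hu.unit
  rw [P.zollMetric_tangent hs ht] at hn
  have he := P.eq (p 2)
  have h1 := sin_sq_add_cos_sq R
  have h2 := sin_sq_add_cos_sq φ
  simp only [dotProduct, Fin.sum_univ_three] at hs ht
  generalize h (p 2) = h0, k (p 2) = k0 at *
  generalize p 0 = x, p 1 = y, p 2 = z, u 0 = x1, u 1 = y1, u 2 = z1, sin R = c, cos R = C,
    sin φ = s, cos φ = κ at *
  subst hheight
  linear_combination (s ^ 2 + κ ^ 2 * c ^ 2 * k0 ^ 2) * hs - 2 * (1 + h0) * c * k0 * κ ^ 2 * hang +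
    2 * s * κ * (1 + h0) * ht - 2 * s * κ * (C * κ) * hspeed + κ ^ 2 * (1 + h0) ^ 2 * hn -
    κ ^ 2 * (1 + k0 * (2 + h0)) * ((1 + h0) * z1 - C * s) * hspeed +
    κ ^ 2 * ((2 + h0) - c ^ 2 * k0) * he - κ ^ 2 * k0 * (2 + h0) * (h1 + C ^ 2 * h2) + h2

theorem exists_phase_turn (P : IsZollProfile h k Ψ H) {p u m : Fin 3 → ℝ} {ρ : ℝ → ℝ} {s : ℝ}
    (hu : IsUnitTangent h p u) (hm : IsUnitNormal h p u m)
    (hsin : sin (ρ s) = p 0 * (cos s * u 1 - sin s * m 1) - p 1 * (cos s * u 0 - sin s * m 0))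
    (hcos : cos (ρ s) ≠ 0) :
    turnedFst h k p u m ρ s ^ 2 + turnedSnd h k p u m ρ s ^ 2 = 1 ∧
      ∃ φ, cos φ = p 2 / cos (ρ s) ∧ sin φ = turnedSin h p u m ρ s := by
  have hus := hu.turn hm s
  have hcl := P.clairaut hus
  simp only [Pi.sub_apply, Pi.smul_apply, smul_eq_mul] at hcl
  have hσ : turnedSin h p u m ρ s * cos (ρ s) = -((1 + h (p 2)) * (cos s * u 2 - sin s * m 2)) :=
    div_mul_cancel₀ _ hcos
  obtain ⟨φ, hφ1, hφ2⟩ := exists_cos_sin_eq (x := p 2 / cos (ρ s)) (y := turnedSin h p u m ρ s) (by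
    have h1 := cos_sq' (ρ s)
    rw [hsin] at h1
    refine mul_right_cancel₀ (pow_ne_zero 2 hcos) ?_
    rw [add_mul, div_pow, div_mul_cancel₀ _ (pow_ne_zero 2 hcos), ← mul_pow, hσ]
    linear_combination hcl - h1)
  refine ⟨?_, φ, hφ1, hφ2⟩
  have := P.rotation_sq_add_sq (R := ρ s) (φ := φ) hus hsin.symm
    (by rw [hφ1, mul_div_cancel₀ _ hcos])
    (by simp only [Pi.sub_apply, Pi.smul_apply, smul_eq_mul]; rw [hφ2]; linear_combination hσ)
  rw [hφ1, hφ2] at this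
  exact this

theorem exists_canonicalImage (P : IsZollProfile h k Ψ H) {R Θ φ D : ℝ}
    (hD : ∀ ρ σ : ℝ → ℝ, ρ 0 = R → σ 0 = sin φ → HasDerivAt ρ (-sin φ) 0 →
      HasDerivAt σ (sin R / cos R * (1 - sin φ ^ 2)) 0 → HasDerivAt (fun s => Ψ (ρ s) (σ s)) D 0)
    (hR₁ : -(π / 2) < R) (hR₂ : R < π / 2) :
    ∃ v, IsCanonicalImage h (phasePoint (Θ + Ψ R (sin φ)) R φ)
      (phaseVelocity h k (Θ + Ψ R (sin φ)) R φ) R Θ v := by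
  have hpos : 0 < cos R := cos_pos_of_mem_Ioo ⟨hR₁, hR₂⟩
  have hR := hpos.ne'
  have hφ := P.hasPhase_phase R Θ φ
  have hu := P.isUnitTangent_phase (Θ + Ψ R (sin φ)) R φ
  have hm := P.isUnitNormal_phase (Θ + Ψ R (sin φ)) R φ
  have hang := P.hasDerivAt_angular (Θ + Ψ R (sin φ)) R φ
  set β₀ := Θ + Ψ R (sin φ) with hβ₀
  set p := phasePoint β₀ R φ
  set u := phaseVelocity h k β₀ R φ
  set m := phaseNormal h k β₀ R φ
  set c : ℝ → ℝ := fun s => p 0 * (cos s * u 1 - sin s * m 1) - p 1 * (cos s * u 0 - sin s * m 0)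
    with hc
  have hc0 : c 0 = sin R := by simpa [hc] using hφ.angular
  have hlt : sin R ^ 2 < 1 := by nlinarith [sin_sq_add_cos_sq R]
  obtain ⟨hlt1, hlt2⟩ := abs_lt.1 ((sq_lt_one_iff_abs_lt_one _).1 hlt)
  -- By Clairaut, `sin (ρ s)` must be the angular momentum of the turned vector; since `|R| < π /
  -- 2`, the arcsine is the right branch and is differentiable.
  set ρ : ℝ → ℝ := fun s => arcsin (c s) with hρdef
  have hρ : ρ 0 = R := by rw [hρdef]; simp only [hc0]; exact arcsin_sin hR₁.le hR₂.le
  have hρ' : HasDerivAt ρ (-sin φ) 0 := by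
    have h1 := (hasDerivAt_arcsin (x := c 0) (by rw [hc0]; exact hlt1.ne')
      (by rw [hc0]; exact hlt2.ne)).comp 0 hang
    refine h1.congr_deriv ?_
    rw [hc0, ← cos_sq', sqrt_sq hpos.le]
    field_simp
  obtain ⟨z1, z2, z3⟩ := turned_zero (m := m) hφ hR hρ
  have hσ := P.hasDerivAt_turnedSin (β := β₀) hR hρ hρ'
  have hX := P.hasDerivAt_turnedFst (β := β₀) hR hρ hρ'
  have hY := P.hasDerivAt_turnedSnd (β := β₀) hR hρ hρ'
  rw [← hβ₀] at z2 z3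
  set σ := turnedSin h p u m ρ
  set X := turnedFst h k p u m ρ
  set Y := turnedSnd h k p u m ρ
  have ev : ∀ᶠ s in 𝓝 (0 : ℝ), c s ∈ Set.Ioo (-1 : ℝ) 1 :=
    hang.continuousAt (Ioo_mem_nhds (by rw [hc0]; exact hlt1) (by rw [hc0]; exact hlt2))
  have hphase : ∀ s, c s ∈ Set.Ioo (-1 : ℝ) 1 → X s ^ 2 + Y s ^ 2 = 1 ∧
      ∃ φs, cos φs = p 2 / cos (ρ s) ∧ sin φs = σ s := fun s hs =>
    P.exists_phase_turn hu hm (sin_arcsin hs.1.le hs.2.le)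
      (cos_pos_of_mem_Ioo ⟨neg_pi_div_two_lt_arcsin.2 hs.1, arcsin_lt_pi_div_two.2 hs.2⟩).ne'
  obtain ⟨β, β', hβ, hβ', hev⟩ := exists_angle hX hY z2 z3 (ev.mono fun s hs => (hphase s hs).1)
  have hΨ := hD ρ σ hρ z1 hρ' hσ
  refine ⟨(-sin φ, β' - D), m, hm, ρ, fun s => β s - Ψ (ρ s) (σ s), hρ, ?_, hρ',
    hβ'.fun_sub hΨ, ?_⟩
  · simp only [hβ, hρ, z1]
    rw [hβ₀]
    ring
  filter_upwards [ev, hev] with s hs1 hs2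
  have hρ1 : -(π / 2) < ρ s := neg_pi_div_two_lt_arcsin.2 hs1.1
  have hρ2 : ρ s < π / 2 := arcsin_lt_pi_div_two.2 hs1.2
  obtain ⟨-, φs, hφ1, hφ2⟩ := hphase s hs1
  refine P.projectsTo_iff.2 ⟨hρ1, hρ2, hu.turn hm s, φs,
    (hasPhase_turn_iff (cos_pos_of_mem_Ioo ⟨hρ1, hρ2⟩).ne').2
    ⟨sin_arcsin hs1.1.le hs1.2.le, hφ1, hφ2, ?_, ?_⟩⟩
  · rw [sub_add_cancel]
    exact hs2.1
  · rw [sub_add_cancel]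
    exact hs2.2

end IsZollProfile

/-! ### The odd polynomial and the indicatrix -/

theorem isZollProfile_oddPolynomial {α : ℕ → ℝ} {n : ℕ} {h : ℝ → ℝ}
    (hh : ∀ x, h x = ∑ k ∈ Finset.range (n + 1), α k * x ^ (2 * k + 1))
    (hα : ∑ k ∈ Finset.range (n + 1), α k = 0)
    (hne : ∀ x ∈ Set.Icc (-1 : ℝ) 1, 1 + h x ≠ 0) :
    IsZollProfile h (oddQuotient α n) (phaseRotation α n) (phaseDelay α n) where
  eq x := by rw [hh, one_sub_sq_mul_oddQuotient hα]
  contDiff := contDiff_oddQuotient α n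
  pos x hx := by
    have hmem : x ∈ Set.Icc (-1 : ℝ) 1 := abs_le.1 ((sq_le_one_iff_abs_le_one x).1 hx)
    -- As `1 + h` is `1` at the origin and has no zero on `[-1, 1]`, the intermediate value theorem
    -- makes it positive.
    have h0 : 1 + h 0 = 1 := by simp [hh]
    have hc : Continuous fun x => 1 + h x := by
      rw [funext hh]
      fun_prop
    by_contra hneg
    obtain ⟨y, hy, hy0⟩ := (isPreconnected_Icc.intermediate_value hmem
      (Set.mem_Icc.2 ⟨by norm_num, zero_le_one⟩) hc.continuousOn)
      ⟨not_lt.1 hneg, by rw [h0]; exact zero_le_one⟩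
    exact hne y hy hy0
  rotation := hasDerivAt_phaseRotation_sin α n
  delay R φ := by
    rw [hh]
    exact hasDerivAt_phaseDelay_sin α n R φ
  rotation_zero R := by simp [phaseRotation, cosPowPrimitive_zero]
  continuous_delay := continuous_phaseDelay α n

theorem mainTheorem5 (n : ℕ) (a b : ℕ → ℝ) (h : ℝ → ℝ)
    (hh : ∀ x, h x = ∑ k ∈ Finset.range (n + 1), a (2 * k + 1) * x ^ (2 * k + 1))
    (hsum : ∑ k ∈ Finset.range (n + 1), a (2 * k + 1) = 0)
    (hG : ∀ x ∈ Set.Icc (-1 : ℝ) 1, 0 < zollGaussCurvature h x)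
    (hb : ∀ k < n, b (2 * k + 1) = 2 * ((k : ℝ) + 1) * (2 * (k : ℝ) + 3) * a (2 * k + 3))
    (R Θ : ℝ) (hR₁ : -(Real.pi / 2) < R) (hR₂ : R < Real.pi / 2) :
    finslerIndicatrix h R Θ =
      {v : ℝ × ℝ | v.1 ^ 2 ≤ 1 ∧ ∃ ε : ℝ, (ε = 1 ∨ ε = -1) ∧
        v.2 = ε * (√(1 - v.1 ^ 2) / Real.cos R)
          - ∑ k ∈ Finset.range (n + 1),
              a (2 * k + 1) * Real.cos R ^ (2 * k) * (1 + 2 * (k : ℝ) * v.1 ^ 2)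
                * (1 - v.1 ^ 2) ^ k
          - Real.cos R ^ 2 * v.1 ^ 4 *
              ∑ k ∈ Finset.range n, b (2 * k + 1) * Real.cos R ^ (2 * k) *
                ∑ ρ ∈ Finset.range (k + 1),
                  (-1 : ℝ) ^ ρ / (2 * (ρ : ℝ) + 3) * (k.choose ρ : ℝ) * v.1 ^ (2 * ρ)} := by
  set α : ℕ → ℝ := fun k => a (2 * k + 1) with hα
  have P : IsZollProfile h (oddQuotient α n) (phaseRotation α n) (phaseDelay α n) :=
    isZollProfile_oddPolynomial hh hsum fun x hx h0 => by
      -- If `1 + h x = 0`, the curvature quotient takes the value `0` of a division by zero,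
      -- contrary to positivity.
      have := hG x hx
      simp [zollGaussCurvature, h0] at this
  have hR : cos R ≠ 0 := (cos_pos_of_mem_Ioo ⟨hR₁, hR₂⟩).ne'
  have hD : ∀ φ, ∀ ρ σ : ℝ → ℝ, ρ 0 = R → σ 0 = sin φ → HasDerivAt ρ (-sin φ) 0 →
      HasDerivAt σ (sin R / cos R * (1 - sin φ ^ 2)) 0 →
      HasDerivAt (fun s => phaseRotation α n (ρ s) (σ s)) (indicatrixShift α n R (sin φ)) 0 :=
    fun φ ρ σ h1 h2 h3 h4 => hasDerivAt_phaseRotation_curve hsum h1 h2 hR h3 h4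
  -- The right-hand side is even, so `v₁ = -sin φ` may replace `sin φ`.
  have hshift : ∀ x y : ℝ, x = -y → indicatrixShift α n R y =
      ∑ k ∈ Finset.range (n + 1),
        a (2 * k + 1) * cos R ^ (2 * k) * (1 + 2 * (k : ℝ) * x ^ 2) * (1 - x ^ 2) ^ k +
      cos R ^ 2 * x ^ 4 * ∑ k ∈ Finset.range n, b (2 * k + 1) * cos R ^ (2 * k) *
        ∑ ρ ∈ Finset.range (k + 1),
          (-1 : ℝ) ^ ρ / (2 * (ρ : ℝ) + 3) * (k.choose ρ : ℝ) * x ^ (2 * ρ) := by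
    rintro x y rfl
    rw [hα, indicatrixShift_eq n a b hb]
    simp only [neg_sq, (even_two_mul _).neg_pow, (show Even 4 by decide).neg_pow]
  ext v
  constructor
  · rintro ⟨p, u, hu, hp, hv⟩
    obtain ⟨-, -, -, φ, hφ⟩ := P.projectsTo_iff.1 hp
    obtain ⟨rfl, rfl⟩ := P.eq_phase hu hφ
    obtain ⟨h1, h2⟩ := P.canonicalImage_eq (hD φ) hR hv
    have h3 : √(1 - v.1 ^ 2) = |cos φ| := by
      rw [h1, neg_sq, ← cos_sq', sqrt_sq_eq_abs]
    rw [hshift _ _ h1] at h2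
    refine ⟨by rw [h1, neg_sq]; exact sin_sq_le_one φ, ?_⟩
    rcases le_total 0 (cos φ) with hc | hc
    · refine ⟨-1, Or.inr rfl, ?_⟩
      rw [h3, abs_of_nonneg hc, h2]
      ring
    · refine ⟨1, Or.inl rfl, ?_⟩
      rw [h3, abs_of_nonpos hc, h2]
      ring
  · rintro ⟨h1, ε, hε, h2⟩
    have hε2 : ε ^ 2 = 1 := by rcases hε with rfl | rfl <;> norm_num
    -- The phase is forced by `v₁ = -sin φ` and `ε * √(1 - v₁²) = -cos φ`.
    obtain ⟨φ, hc, hs⟩ := exists_cos_sin_eq (x := -(ε * √(1 - v.1 ^ 2))) (y := -v.1) (by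
      rw [neg_sq, neg_sq, mul_pow, hε2, sq_sqrt (by linarith)]
      ring)
    obtain ⟨w, hw⟩ := P.exists_canonicalImage (Θ := Θ) (hD φ) hR₁ hR₂
    obtain ⟨w1, w2⟩ := P.canonicalImage_eq (hD φ) hR hw
    -- An image vector at this phase exists and its components are determined, so it must be `v`.
    have hwv : w = v := by
      refine Prod.ext (by rw [w1, hs, neg_neg]) ?_
      rw [w2, h2, hshift v.1 (sin φ) (by rw [hs, neg_neg]), hc]
      ring
    rw [← hwv]
    exact ⟨_, _, P.isUnitTangent_phase _ R φ, P.projectsTo_phase Θ φ hR₁ hR₂, hw⟩
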